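/- Consider the modified Camassa–Holm equation $u_t-u_{xxt}=uu_{xxx}+2u_xu_{xx}-3u^2u_x$. A function $\varphi\in H^1_{loc}(\mathbb R)$ (identified with its continuous representative) is a traveling wave with speed $c\in\mathbb R$, $u(x,t)=\varphi(x-ct)$, if for some $a\in\mathbb R$ $$(\varphi')^2+2\varphi^3-2c\varphi=((\varphi-c)^2)''+a\quad\text{in the sense of distributions.}$$ A continuous function has a peak at $x$ if it is smooth on either side of $x$ and its one-sided derivatives satisfy $0\ne\lim_{y\uparrow x}\varphi'(y)=-\lim_{y\downarrow x}\varphi'(y)\ne\pm\infty$. A peakon is a traveling wave that has at least one peak and is smooth near every point at which it does not have a peak. Let $z,r,m,M,c\in\mathbb R$ satisfy $z=-m-r-M$, $r^2+m^2+M^2+rm+rM+mM-2c=0$ and $M=c$. Let $F(\theta;k)=\int_0^\theta\frac{dt}{\sqrt{1-k^2\sin^2t}}$ be the incomplete elliptic integral of the first kind, $\mathrm{am}(\cdot\,;k)$ the inverse function of $F(\cdot\,;k)$, and $\mathrm{tn}=\sin\mathrm{am}/\cos\mathrm{am}$. (1) Periodic peakons. Let $z<r<m<M=c$. Put $B=\frac{m-r}{M-m}$,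 $C=\frac{m-z}{M-m}$, $k=\sqrt{B/C}$, $k'=\sqrt{1-k^2}$, $D_1=\frac{\sqrt C\sqrt{c-m}}{2\sqrt2}$, $D_2=B(c-m)$, $D_3=2/D_1$ and $$L=D_3\,F\Big(\arcsin\sqrt{\tfrac{1/B}{1+1/B}}\,;k'\Big).$$ Then periodic peakons $\varphi$ with speed $c$, $\min\varphi=m$ and $\max\varphi=M$ exist. A function $\varphi:\mathbb R\to\mathbb R$ is such a peakon with a trough at $\xi_0$ (i.e. $\varphi(\xi_0)=m$) if and only if $\varphi$ is $L$-periodic and $$\varphi(\xi)=m+D_2\,\mathrm{tn}^2(D_1|\xi-\xi_0|;k')\qquad\text{for }|\xi-\xi_0|\le L/2 .$$ Moreover $L$ is the smallest positive period of every such peakon. (2) Peakons with decay. Let $z<r=m<M=c$. Put $C=\frac{m-z}{M-m}$, $D_4=4C^2(c-m)\big(1-\sqrt{1+1/C}\big)^2$, $D_5=\frac{\sqrt C\sqrt{c-m}}{\sqrt2}$ and $D_6=C\big(1-\sqrt{1+1/C}\big)^2$. A function $\varphi:\mathbb R\to\mathbb R$ is a peakon with speed $c$, $\inf\varphi=m$,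 $\max\varphi=M$, decreasing exponentially to $m$ as $\xi\to\pm\infty$, and with its crest at $\xi_0$ (i.e. $\varphi(\xi_0)=c$), if and only if $$\varphi(\xi)=m+\frac{D_4e^{-D_5|\xi-\xi_0|}}{\big(D_6e^{-D_5|\xi-\xi_0|}-1\big)^2}\qquad\text{for all }\xi\in\mathbb R.$$ -/

import Mathlib

open Set Filter Topology MeasureTheory
open scoped ContDiff

/-- `g` is a weak derivative on the real line of `f`, with `g` in `L²_loc`; for `f` in `L²_loc` this
says `f ∈ H¹_loc(ℝ)` with derivative `g`. -/
def IsL2LocWeakDeriv (f g : ℝ → ℝ) : Prop :=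
  (∀ K : Set ℝ, IsCompact K → MemLp g 2 (volume.restrict K)) ∧
  ∀ η : ℝ → ℝ, ContDiff ℝ ∞ η → HasCompactSupport η →
    ∫ x, f x * deriv η x = - ∫ x, g x * η x

/-- `φ ∈ H¹_loc(ℝ)` (given by its continuous representative) is the profile of a traveling wave
`u(x,t) = φ(x - ct)` of the modified Camassa-Holm equation
`u_t - u_xxt = u u_xxx + 2 u_x u_xx - 3 u² u_x`: for some constant `a`,
`(φ')² + 2 φ³ - 2 c φ = ((φ - c)²)'' + a` in the sense of distributions. -/
def IsTravelingWave (c : ℝ) (φ : ℝ → ℝ) : Prop :=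
  Continuous φ ∧ ∃ g : ℝ → ℝ, IsL2LocWeakDeriv φ g ∧
    ∃ a : ℝ, ∀ η : ℝ → ℝ, ContDiff ℝ ∞ η → HasCompactSupport η →
      ∫ x, (g x ^ 2 + 2 * φ x ^ 3 - 2 * c * φ x) * η x =
        (∫ x, (φ x - c) ^ 2 * iteratedDeriv 2 η x) + a * ∫ x, η x

/-- `φ` is smooth in a neighbourhood of `x`. -/
def SmoothNear (φ : ℝ → ℝ) (x : ℝ) : Prop :=
  ∃ ε > 0, ContDiffOn ℝ ∞ φ (Ioo (x - ε) (x + ε))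

/-- The continuous function `φ` has a peak at `x`: it is smooth on either side of `x`, and its
one-sided slopes at `x` are finite, nonzero and opposite. -/
def HasPeakAt (φ : ℝ → ℝ) (x : ℝ) : Prop :=
  ContinuousAt φ x ∧
  (∃ ε > 0, ContDiffOn ℝ ∞ φ (Ioo (x - ε) x) ∧ ContDiffOn ℝ ∞ φ (Ioo x (x + ε))) ∧
  ∃ s : ℝ, s ≠ 0 ∧ Tendsto (deriv φ) (𝓝[<] x) (𝓝 s) ∧ Tendsto (deriv φ) (𝓝[>] x) (𝓝 (-s))

/-- A peakon with speed `c`: a traveling wave that has a peak, and all of whose singularities are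
peaks (no cusps). -/
def IsPeakon (c : ℝ) (φ : ℝ → ℝ) : Prop :=
  IsTravelingWave c φ ∧ (∃ x, HasPeakAt φ x) ∧ ∀ x, SmoothNear φ x ∨ HasPeakAt φ x

/-- A periodic peakon with minimum `m` and maximum `M`. -/
def IsPeriodicPeakon (c m M : ℝ) (φ : ℝ → ℝ) : Prop :=
  IsPeakon c φ ∧ (∃ T > 0, Function.Periodic φ T) ∧
  IsLeast (range φ) m ∧ IsGreatest (range φ) M

/-- `φ` decreases to `m` exponentially as `ξ → ±∞`. -/
def DecaysExponentiallyTo (φ : ℝ → ℝ) (m : ℝ) : Prop :=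
  ∃ K κ R : ℝ, 0 < κ ∧ AntitoneOn φ (Ici R) ∧ MonotoneOn φ (Iic (-R)) ∧
    ∀ ξ, R ≤ |ξ| → m < φ ξ ∧ φ ξ - m ≤ K * Real.exp (-κ * |ξ|)

/-- A peakon with infimum `m` and maximum `M` that decreases to `m` exponentially at `±∞`. -/
def IsDecayingPeakon (c m M : ℝ) (φ : ℝ → ℝ) : Prop :=
  IsPeakon c φ ∧ IsGLB (range φ) m ∧ IsGreatest (range φ) M ∧ DecaysExponentiallyTo φ m

/-- The incomplete elliptic integral of the first kind
`F(φ, k) = ∫₀^φ dθ / √(1 - k² sin² θ)`. -/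
noncomputable def ellipticF (φ k : ℝ) : ℝ :=
  ∫ θ in (0 : ℝ)..φ, 1 / Real.sqrt (1 - k ^ 2 * Real.sin θ ^ 2)

/-- The amplitude function `am(u, k)`: the inverse function of `φ ↦ F(φ, k)`, which is a
bijection of the real line for `k² < 1`. -/
noncomputable def ellipticAm (u k : ℝ) : ℝ :=
  Function.invFun (fun φ => ellipticF φ k) u

/-- `am(·, k)` is indeed a right inverse of `F(·, k)`. -/
theorem ellipticF_ellipticAm {k : ℝ} (hk : k ^ 2 < 1) (u : ℝ) :
    ellipticF (ellipticAm u k) k = u := by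
  have hpos : ∀ θ : ℝ, 0 < 1 - k ^ 2 * Real.sin θ ^ 2 := fun θ => by
    nlinarith [Real.sin_sq_le_one θ, sq_nonneg k, sq_nonneg (Real.sin θ)]
  have hcont : Continuous fun θ : ℝ => 1 / Real.sqrt (1 - k ^ 2 * Real.sin θ ^ 2) :=
    continuous_const.div (by fun_prop) fun θ => (Real.sqrt_pos.2 (hpos θ)).ne'
  have hone : ∀ θ : ℝ, 1 ≤ 1 / Real.sqrt (1 - k ^ 2 * Real.sin θ ^ 2) := fun θ => by
    rw [le_div_iff₀ (Real.sqrt_pos.2 (hpos θ)), one_mul]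
    exact Real.sqrt_le_one.2 (by nlinarith [mul_nonneg (sq_nonneg k) (sq_nonneg (Real.sin θ))])
  have hint : ∀ a b : ℝ, IntervalIntegrable
      (fun θ : ℝ => 1 / Real.sqrt (1 - k ^ 2 * Real.sin θ ^ 2)) volume a b :=
    fun a b => hcont.intervalIntegrable a b
  have hF : Continuous fun φ => ellipticF φ k :=
    intervalIntegral.continuous_primitive hint 0
  have hge : ∀ a b : ℝ, a ≤ b →
      b - a ≤ ∫ θ in a..b, 1 / Real.sqrt (1 - k ^ 2 * Real.sin θ ^ 2) := fun a b hab => by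
    have h := intervalIntegral.integral_mono_on hab
      (intervalIntegrable_const (c := (1 : ℝ))) (hint a b) (fun x _ => hone x)
    simpa using h
  have hsurj : Function.Surjective fun φ => ellipticF φ k := by
    refine hF.surjective ?_ ?_
    · refine tendsto_atTop_mono' atTop ?_ tendsto_id
      filter_upwards [eventually_ge_atTop 0] with x hx
      have := hge 0 x hx
      simpa [ellipticF] using this
    · refine tendsto_atBot_mono' atBot ?_ tendsto_id
      filter_upwards [eventually_le_atBot 0] with x hx
      have := hge x 0 hx
      rw [ellipticF, intervalIntegral.integral_symm]
      simp only [id]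
      linarith
  exact Function.rightInverse_invFun hsurj u

/-- The Jacobian elliptic function `tn(u, k) = sin am(u, k) / cos am(u, k)`. -/
noncomputable def jacobiTn (u k : ℝ) : ℝ :=
  Real.sin (ellipticAm u k) / Real.cos (ellipticAm u k)

/-! ### Integration by parts against test functions -/

/-! Where `φ` is smooth, the weak equation is the classical one, `φ'² + 2(φ - c)φ'' = 2φ³ - 2cφ -
a`. At a peak `φ'` jumps, so `2(φ - c)φ'`, the derivative of `(φ - c)²`, jumps unless `φ = c`; such
a jump would put a Dirac mass into `((φ - c)²)''` that no other term can balance. Hence peaks sit at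
height `c` (`eq_speed_of_hasPeakAt`).

Multiplying by `φ'` and integrating from a crest gives `(φ - c)φ'² = Q(φ) - Q(c)` for a quartic `Q`
(`IsPeakonProfile.first_integral`). A trough, or the limit at infinity, gives `Q(m) = Q(c)`, which
determines `a`. The relations on `z, r, m, c` are Vieta's formulas for `Q(y) - Q(c)`, so division by
`φ - c` leaves `φ'² = (φ - m)(φ - r)(φ - z)/2`. This first order equation loses uniqueness at `φ =
m`. Putting it back into the second order equation and dividing by `φ - c` again gives `φ'' = G(φ)`
with `G` polynomial, for which the Picard–Lindelöf uniqueness theorem also carries a solution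
through the trough. The data at a crest are known: value `c` and right slope `-√(profileCubic m r z
c)`. Thus a profile coincides with any explicit arc solving the same problem, up to the end of the
arc (`IsPeakonProfile.eqOn_arc`); reflection treats the left side.

The arcs are explicit. For `r < m` the substitution `φ = m + (m - r)T²` turns the first order
equation into the one satisfied by `tn`, and the arc returns to `c` after time `L`. For `r = m` the
cubic has a double root, `m` is only approached at infinity, and a rational function of an
exponential solves the equation. Conversely, a function glued from arcs is a weak solution because
`(φ - c)φ'` is continuous across crests (`isPeakon_of_pointwise`). -/

theorem integrable_mul_of_bounded_on_tsupport {f η : ℝ → ℝ} (hf : AEStronglyMeasurable f volume)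
    (hη : Continuous η) (hs : HasCompactSupport η) {K : ℝ} (hK : ∀ x ∈ tsupport η, |f x| ≤ K) :
    Integrable fun x => f x * η x := by
  refine Integrable.mono' ((hη.integrable_of_hasCompactSupport hs).norm.const_mul K)
    (hf.mul hη.aestronglyMeasurable) (Eventually.of_forall fun x => ?_)
  rw [norm_mul, Real.norm_eq_abs (f x)]
  by_cases hx : x ∈ tsupport η
  · exact mul_le_mul_of_nonneg_right (hK x hx) (norm_nonneg _)
  · simp [image_eq_zero_of_notMem_tsupport hx]

theorem integrable_mul_of_continuousOn_tsupport {f η : ℝ → ℝ} (hf : AEStronglyMeasurable f volume)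
    (hη : Continuous η) (hs : HasCompactSupport η) (hc : ContinuousOn f (tsupport η)) :
    Integrable fun x => f x * η x := by
  obtain ⟨K, hK⟩ := hs.isCompact.exists_bound_of_continuousOn hc
  exact integrable_mul_of_bounded_on_tsupport hf hη hs hK

theorem continuous_mul_of_continuousOn {f η : ℝ → ℝ} {U : Set ℝ} (hU : IsOpen U)
    (hf : ContinuousOn f U) (hη : Continuous η) (hs : tsupport η ⊆ U) :
    Continuous fun x => f x * η x := by
  rw [continuous_iff_continuousAt]
  intro x
  by_cases hx : x ∈ tsupport η
  · exact (hf.continuousAt (hU.mem_nhds (hs hx))).mul hη.continuousAt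
  · have : (fun x => f x * η x) =ᶠ[𝓝 x] fun _ => 0 := by
      filter_upwards [notMem_tsupport_iff_eventuallyEq.1 hx] with y hy
      simp [hy]
    exact continuousAt_const.congr this.symm

/-- Integration by parts against a test function, for a continuous function that is differentiable
off a countable set. -/
theorem integral_mul_deriv_eq_neg_off_countable {f f' η : ℝ → ℝ} {U s : Set ℝ} (hU : IsOpen U)
    (hs : s.Countable) (hf : ContinuousOn f U) (hd : ∀ x ∈ U \ s, HasDerivAt f (f' x) x)
    (hη : ContDiff ℝ ∞ η) (hc : HasCompactSupport η) (ht : tsupport η ⊆ U)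
    (hi : Integrable fun x => f' x * η x) :
    ∫ x, f x * deriv η x = - ∫ x, f' x * η x := by
  have hη' : Continuous (deriv η) := hη.continuous_deriv (by simp)
  have ht' : tsupport (deriv η) ⊆ U := tsupport_deriv_subset.trans ht
  have hcont : Continuous fun x => f x * η x := continuous_mul_of_continuousOn hU hf hη.continuous ht
  have hi' : Integrable fun x => f x * deriv η x :=
    (continuous_mul_of_continuousOn hU hf hη' ht').integrable_of_hasCompactSupport hc.deriv.mul_left
  obtain ⟨R, hR⟩ := hc.isCompact.isBounded.subset_ball 0
  have hz : ∀ x, x ∉ Ioo (-R) R → η x = 0 := fun x hx => by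
    refine image_eq_zero_of_notMem_tsupport fun h => hx ?_
    have := hR h
    rw [Real.ball_eq_Ioo] at this
    simpa using this
  have hz' : ∀ x, x ∉ Ioo (-R) R → deriv η x = 0 := fun x hx => by
    refine image_eq_zero_of_notMem_tsupport fun h => hx ?_
    have := hR (tsupport_deriv_subset h)
    rw [Real.ball_eq_Ioo] at this
    simpa using this
  have hsub : Function.support (fun x => f' x * η x + f x * deriv η x) ⊆ Ioc (-R) R := by
    intro x hx
    by_contra h
    have h' : x ∉ Ioo (-R) R := fun h'' => h (Ioo_subset_Ioc_self h'')
    exact hx (by simp [hz x h', hz' x h'])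
  -- The fundamental theorem of calculus tolerates a countable exceptional set since `f * η` is
  -- continuous; the boundary terms at `±R` vanish.
  have hI := integral_eq_of_hasDerivAt_off_countable (fun x => f x * η x)
    (fun x => f' x * η x + f x * deriv η x) (a := -R) (b := R) hs hcont.continuousOn ?_
    (hi.add hi').intervalIntegrable
  · rw [intervalIntegral.integral_eq_integral_of_support_subset hsub, integral_add hi hi',
      hz R (by simp), hz (-R) (by simp)] at hI
    linarith
  · rintro x ⟨-, hx⟩
    by_cases hxt : x ∈ tsupport η
    · exact (hd x ⟨ht hxt, hx⟩).mul (hη.differentiable (by simp) x).hasDerivAt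
    · have h0 : η =ᶠ[𝓝 x] 0 := notMem_tsupport_iff_eventuallyEq.1 hxt
      have : (fun x => f x * η x) =ᶠ[𝓝 x] fun _ => 0 := by
        filter_upwards [h0] with y hy
        simp [hy]
      have h1 := (hasDerivAt_const x (0 : ℝ)).congr_of_eventuallyEq this
      have h2 : deriv η x = 0 := by rw [h0.deriv_eq]; simp
      have h3 : η x = 0 := h0.eq_of_nhds
      simpa [h2, h3] using h1

/-! ### From the weak equation to a pointwise one -/

/-- A weak derivative agrees almost everywhere with the classical one where the latter is
continuous. -/
theorem IsL2LocWeakDeriv.ae_eq_deriv {φ g : ℝ → ℝ} (h : IsL2LocWeakDeriv φ g) {U : Set ℝ}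
    (hU : IsOpen U) (hφ : ContDiffOn ℝ ∞ φ U) : ∀ᵐ x, x ∈ U → g x = deriv φ x := by
  have hg : LocallyIntegrable g := by
    rw [locallyIntegrable_iff]
    intro K hK
    have : IsFiniteMeasure (volume.restrict K) := ⟨by simpa using hK.measure_lt_top⟩
    exact (h.1 K hK).integrable (by norm_num)
  have hd : ContinuousOn (deriv φ) U := hφ.continuousOn_deriv_of_isOpen hU (by simp)
  have := hU.ae_eq_zero_of_integral_contDiff_smul_eq_zero (f := fun x => g x - deriv φ x)
    (μ := volume) ((hg.locallyIntegrableOn U).sub (hd.locallyIntegrableOn hU.measurableSet)) ?_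
  · filter_upwards [this] with x hx hxU
    linarith [hx hxU]
  · intro η hη hc ht
    have hm : AEStronglyMeasurable (deriv φ) volume :=
      (measurable_deriv φ).aestronglyMeasurable
    have hi := integrable_mul_of_continuousOn_tsupport hm hη.continuous hc (hd.mono ht)
    have hi' : Integrable fun x => g x * η x := by
      simpa [mul_comm] using hg.integrable_smul_left_of_hasCompactSupport hη.continuous hc
    have h1 := integral_mul_deriv_eq_neg_off_countable hU countable_empty hφ.continuousOn
      (fun x hx => ((hφ.differentiableOn (by simp)).differentiableAt
        (hU.mem_nhds hx.1)).hasDerivAt) hη hc ht hi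
    have h2 := h.2 η hη hc
    have : (fun x => η x • (g x - deriv φ x)) = fun x => g x * η x - deriv φ x * η x := by
      ext x; simp; ring
    rw [this, integral_sub hi' hi]
    linarith

theorem ContDiffOn.hasDerivAt_of_isOpen {φ : ℝ → ℝ} {U : Set ℝ} (hφ : ContDiffOn ℝ ∞ φ U)
    (hU : IsOpen U) {x : ℝ} (hx : x ∈ U) : HasDerivAt φ (deriv φ x) x :=
  ((hφ.differentiableOn (by simp)).differentiableAt (hU.mem_nhds hx)).hasDerivAt

theorem hasDerivAt_sub_const_sq {φ : ℝ → ℝ} {c d x : ℝ} (h : HasDerivAt φ d x) :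
    HasDerivAt (fun x => (φ x - c) ^ 2) (2 * (φ x - c) * d) x := by
  have := (h.sub_const c).fun_pow 2
  simpa using this

theorem hasDerivAt_two_mul_sub_mul {φ ψ : ℝ → ℝ} {c d e x : ℝ} (h : HasDerivAt φ d x)
    (h' : HasDerivAt ψ e x) :
    HasDerivAt (fun x => 2 * (φ x - c) * ψ x) (2 * d * ψ x + 2 * (φ x - c) * e) x :=
  ((h.sub_const c).const_mul 2).mul h'

/-- Where it is smooth, a weak solution solves the differential equation pointwise. -/
theorem pointwise_equation {c a : ℝ} {φ g : ℝ → ℝ} (hφ : Continuous φ)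
    (hg : IsL2LocWeakDeriv φ g)
    (hw : ∀ η : ℝ → ℝ, ContDiff ℝ ∞ η → HasCompactSupport η →
      ∫ x, (g x ^ 2 + 2 * φ x ^ 3 - 2 * c * φ x) * η x =
        (∫ x, (φ x - c) ^ 2 * iteratedDeriv 2 η x) + a * ∫ x, η x)
    {U : Set ℝ} (hU : IsOpen U) (hs : ContDiffOn ℝ ∞ φ U) {x : ℝ} (hx : x ∈ U) :
    deriv φ x ^ 2 + 2 * (φ x - c) * deriv (deriv φ) x = 2 * φ x ^ 3 - 2 * c * φ x - a := by
  have hs1 : ContDiffOn ℝ ∞ (deriv φ) U := ((contDiffOn_infty_iff_deriv_of_isOpen hU).1 hs).2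
  have hc1 : ContinuousOn (deriv φ) U := hs1.continuousOn
  have hc2 : ContinuousOn (deriv (deriv φ)) U := hs1.continuousOn_deriv_of_isOpen hU (by simp)
  -- The defect of the equation. It is continuous on `U`, so vanishing almost everywhere, obtained
  -- by testing, makes it vanish identically there.
  set e : ℝ → ℝ := fun x => 2 * φ x ^ 3 - 2 * c * φ x - a - deriv φ x ^ 2
      - 2 * (φ x - c) * deriv (deriv φ) x with he
  have hec : ContinuousOn e U := by
    have := hφ.continuousOn (s := U)
    fun_prop
  have hae : ∀ᵐ x, x ∈ U → e x = 0 := by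
    refine hU.ae_eq_zero_of_integral_contDiff_smul_eq_zero
      (hec.locallyIntegrableOn hU.measurableSet) ?_
    intro η hη hc ht
    have hη' : ContDiff ℝ ∞ (deriv η) := (contDiff_infty_iff_deriv.1 hη).2
    have hint : ∀ f : ℝ → ℝ, Measurable f → ContinuousOn f U → Integrable fun x => f x * η x :=
      fun f hm hf => integrable_mul_of_continuousOn_tsupport hm.aestronglyMeasurable
        hη.continuous hc (hf.mono ht)
    have hint' : ∀ f : ℝ → ℝ, Measurable f → ContinuousOn f U →
        Integrable fun x => f x * deriv η x :=
      fun f hm hf => integrable_mul_of_continuousOn_tsupport hm.aestronglyMeasurable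
        hη'.continuous hc.deriv (hf.mono (tsupport_deriv_subset.trans ht))
    have hm0 := hφ.measurable
    have hm1 := measurable_deriv φ
    have hm2 := measurable_deriv (deriv φ)
    have hφU := hφ.continuousOn (s := U)
    have e1 := integral_mul_deriv_eq_neg_off_countable (f := fun x => (φ x - c) ^ 2)
      (f' := fun x => 2 * (φ x - c) * deriv φ x) hU countable_empty
      (by fun_prop) (fun x hx => hasDerivAt_sub_const_sq (hs.hasDerivAt_of_isOpen hU hx.1)) hη'
      hc.deriv (tsupport_deriv_subset.trans ht)
      (hint' _ (by fun_prop) (by fun_prop))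
    have e2 := integral_mul_deriv_eq_neg_off_countable (f := fun x => 2 * (φ x - c) * deriv φ x)
      (f' := fun x => 2 * deriv φ x * deriv φ x + 2 * (φ x - c) * deriv (deriv φ) x) hU
      countable_empty (by fun_prop)
      (fun x hx => hasDerivAt_two_mul_sub_mul (hs.hasDerivAt_of_isOpen hU hx.1)
        (hs1.hasDerivAt_of_isOpen hU hx.1)) hη
      hc ht (hint _ (by fun_prop) (by fun_prop))
    have e3 := hw η hη hc
    have e4 : ∫ x, (g x ^ 2 + 2 * φ x ^ 3 - 2 * c * φ x) * η x =
        ∫ x, (deriv φ x ^ 2 + 2 * φ x ^ 3 - 2 * c * φ x) * η x := by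
      refine integral_congr_ae ?_
      filter_upwards [hg.ae_eq_deriv hU hs] with x hx
      by_cases hxt : x ∈ tsupport η
      · rw [hx (ht hxt)]
      · simp [image_eq_zero_of_notMem_tsupport hxt]
    rw [show iteratedDeriv 2 η = deriv (deriv η) by
      rw [iteratedDeriv_succ, iteratedDeriv_one], e1, e2, e4] at e3
    have e5 : (fun x => η x • e x) = fun x =>
        ((deriv φ x ^ 2 + 2 * φ x ^ 3 - 2 * c * φ x) * η x - a * η x)
        - (2 * deriv φ x * deriv φ x + 2 * (φ x - c) * deriv (deriv φ) x) * η x := by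
      ext x; simp [he]; ring
    rw [e5, integral_sub, integral_sub, integral_const_mul, e3]
    · ring
    · exact hint _ (by fun_prop) (by fun_prop)
    · exact hint (fun _ => a) (by fun_prop) (by fun_prop)
    · exact (hint _ (by fun_prop) (by fun_prop)).sub (hint (fun _ => a) (by fun_prop) (by fun_prop))
    · exact hint _ (by fun_prop) (by fun_prop)
  have := Measure.eqOn_open_of_ae_eq (μ := volume) (g := fun _ => 0)
    ((ae_restrict_iff' hU.measurableSet).2 hae) hU hec continuousOn_const hx
  simp only [he] at this
  linarith

/-- A weak solution takes the value `c` at each of its peaks. -/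
theorem eq_speed_of_hasPeakAt {c a : ℝ} {φ g : ℝ → ℝ} (hφ : Continuous φ)
    (hg : IsL2LocWeakDeriv φ g)
    (hw : ∀ η : ℝ → ℝ, ContDiff ℝ ∞ η → HasCompactSupport η →
      ∫ x, (g x ^ 2 + 2 * φ x ^ 3 - 2 * c * φ x) * η x =
        (∫ x, (φ x - c) ^ 2 * iteratedDeriv 2 η x) + a * ∫ x, η x)
    {p : ℝ} (hp : HasPeakAt φ p) : φ p = c := by
  obtain ⟨-, ⟨ε, hε, hl, hr⟩, s, hs0, hsl, hsr⟩ := hp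
  have hbl : ∀ᶠ x in 𝓝[<] p, |deriv φ x| ≤ |s| + 1 := by
    filter_upwards [hsl.abs.eventually (gt_mem_nhds (lt_add_one |s|))] with x hx using hx.le
  have hbr : ∀ᶠ x in 𝓝[>] p, |deriv φ x| ≤ |s| + 1 := by
    filter_upwards [hsr.abs.eventually (gt_mem_nhds (by rw [abs_neg]; exact lt_add_one |s|))]
      with x hx using hx.le
  obtain ⟨l, hlp, hl'⟩ := mem_nhdsLT_iff_exists_Ioo_subset.1
    (hbl.and (Ioo_mem_nhdsLT (show p - ε < p by linarith)))
  obtain ⟨u, hup, hu'⟩ := mem_nhdsGT_iff_exists_Ioo_subset.1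
    (hbr.and (Ioo_mem_nhdsGT (show p < p + ε by linarith)))
  simp only [mem_Iio, mem_Ioi] at hlp hup
  set V : Set ℝ := Ioo (p - ε) p ∪ Ioo p (p + ε) with hV
  have hVo : IsOpen V := isOpen_Ioo.union isOpen_Ioo
  have hVs : ContDiffOn ℝ ∞ φ V := hl.union_of_isOpen hr isOpen_Ioo isOpen_Ioo
  have hVs1 : ContDiffOn ℝ ∞ (deriv φ) V := ((contDiffOn_infty_iff_deriv_of_isOpen hVo).1 hVs).2
  have hUV : ∀ x ∈ Ioo l u \ {p}, x ∈ V ∧ |deriv φ x| ≤ |s| + 1 := by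
    rintro x ⟨⟨h1, h2⟩, h3⟩
    rcases lt_or_gt_of_ne h3 with h | h
    · exact ⟨Or.inl (hl' ⟨h1, h⟩).2, (hl' ⟨h1, h⟩).1⟩
    · exact ⟨Or.inr (hu' ⟨h, h2⟩).2, (hu' ⟨h, h2⟩).1⟩
  obtain ⟨η, hηU, hηc, hη, -, hηp⟩ := exists_contDiff_tsupport_subset (n := ⊤)
    (Ioo_mem_nhds hlp hup)
  replace hη : ContDiff ℝ ∞ η := hη
  have hη' : ContDiff ℝ ∞ (deriv η) := (contDiff_infty_iff_deriv.1 hη).2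
  have hηU' : tsupport (deriv η) ⊆ Ioo l u := tsupport_deriv_subset.trans hηU
  have hm1 := measurable_deriv φ
  have hm0 := hφ.measurable
  have hd1 : ∀ x ∈ Ioo l u \ {p}, HasDerivAt φ (deriv φ x) x := fun x hx =>
    hVs.hasDerivAt_of_isOpen hVo (hUV x hx).1
  -- modify the derivative at `p` so that it is bounded everywhere on the interval
  set d : ℝ → ℝ := ({p}ᶜ : Set ℝ).indicator (deriv φ) with hd
  have hdm : Measurable d := hm1.indicator (measurableSet_singleton p).compl
  have hdne : ∀ x ≠ p, d x = deriv φ x := fun x hx => by simp [hd, hx]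
  have hdb : ∀ x ∈ Ioo l u, |d x| ≤ |s| + 1 := by
    intro x hx
    by_cases hxp : x = p
    · subst hxp; simp [hd]; positivity
    · rw [hdne x hxp]; exact (hUV x ⟨hx, hxp⟩).2
  have hcomp : ∀ η : ℝ → ℝ, Continuous η → HasCompactSupport η → tsupport η ⊆ Ioo l u →
      ∀ f : ℝ → ℝ, Continuous f → Integrable fun x => f x * d x * η x := by
    intro η hη hc ht f hf
    have := integrable_mul_of_bounded_on_tsupport (f := d) (η := fun x => f x * η x)
      hdm.aestronglyMeasurable (hf.mul hη) hc.mul_left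
      (fun x hx => hdb x (ht (tsupport_mul_subset_right hx)))
    exact this.congr (Eventually.of_forall fun x => by ring)
  have hcomp2 : ∀ η : ℝ → ℝ, Continuous η → HasCompactSupport η → tsupport η ⊆ Ioo l u →
      Integrable fun x => d x ^ 2 * η x := by
    intro η hη hc ht
    refine integrable_mul_of_bounded_on_tsupport (K := (|s| + 1) ^ 2)
      (hdm.pow_const 2).aestronglyMeasurable hη hc (fun x hx => ?_)
    rw [abs_pow]
    exact pow_le_pow_left₀ (abs_nonneg _) (hdb x (ht hx)) 2
  set h : ℝ → ℝ := fun x => d x ^ 2 + (2 * φ x ^ 3 - 2 * c * φ x - a) with hh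
  have hhi : Integrable fun x => h x * η x := by
    have h1 := hcomp2 η hη.continuous hηc hηU
    have h2 := integrable_mul_of_continuousOn_tsupport
      (f := fun x => 2 * φ x ^ 3 - 2 * c * φ x - a) (η := η)
      (by fun_prop : Continuous fun x => 2 * φ x ^ 3 - 2 * c * φ x - a).aestronglyMeasurable
      hη.continuous hηc (by fun_prop)
    exact (h1.add h2).congr (Eventually.of_forall fun x => by simp [hh]; ring)
  have e3 := hw η hη hηc
  rw [show iteratedDeriv 2 η = deriv (deriv η) by
      rw [iteratedDeriv_succ, iteratedDeriv_one]] at e3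
  have e1 := integral_mul_deriv_eq_neg_off_countable (f := fun x => (φ x - c) ^ 2)
      (f' := fun x => 2 * (φ x - c) * d x) (s := {p}) isOpen_Ioo (countable_singleton p)
      (by fun_prop) (fun x hx => by
        have := hasDerivAt_sub_const_sq (c := c) (hd1 x hx)
        rwa [← hdne x hx.2] at this) hη'
      hηc.deriv hηU' (hcomp _ hη'.continuous hηc.deriv hηU' (fun x => 2 * (φ x - c)) (by fun_prop))
  have e4 : ∫ x, (g x ^ 2 + 2 * φ x ^ 3 - 2 * c * φ x) * η x = (∫ x, h x * η x) + a * ∫ x, η x := by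
    rw [← integral_const_mul, ← integral_add hhi
      ((hη.continuous.integrable_of_hasCompactSupport hηc).const_mul a)]
    refine integral_congr_ae ?_
    filter_upwards [hg.ae_eq_deriv hVo hVs, compl_mem_ae_iff.2 (measure_singleton p)] with x hx hxp
    by_cases hxt : x ∈ tsupport η
    · rw [hx (hUV x ⟨hηU hxt, hxp⟩).1, ← hdne x hxp]
      simp only [hh]; ring
    · simp [image_eq_zero_of_notMem_tsupport hxt]
  -- The flux `2(φ - c)φ'` tends to `j` from the left and to `-j` from the right. Adding `2 * j` on
  -- the right gives a continuous `w` with the same derivative off `p`.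
  set j : ℝ := 2 * (φ p - c) * s with hj
  set w : ℝ → ℝ := fun x => if x < p then 2 * (φ x - c) * d x else
    if p < x then 2 * (φ x - c) * d x + 2 * j else j with hwdef
  have hwl : ∀ x < p, w x = 2 * (φ x - c) * d x := fun x hx => by simp [hwdef, hx]
  have hwr : ∀ x > p, w x = 2 * (φ x - c) * d x + 2 * j := fun x hx => by
    simp [hwdef, not_lt.2 (le_of_lt hx), gt_iff_lt.1 hx]
  have hwp : w p = j := by simp [hwdef]
  have hder0 : ∀ x ∈ Ioo l u \ {p}, HasDerivAt (fun x => 2 * (φ x - c) * d x) (h x) x := by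
    intro x hx
    have h1 := hasDerivAt_two_mul_sub_mul (c := c) (hd1 x hx)
      (hVs1.hasDerivAt_of_isOpen hVo (hUV x hx).1)
    have h2 := pointwise_equation hφ hg hw hVo hVs (hUV x hx).1
    have h3 : 2 * deriv φ x * deriv φ x + 2 * (φ x - c) * deriv (deriv φ) x = h x := by
      simp only [hh, hdne x hx.2]; linarith
    rw [h3] at h1
    refine h1.congr_of_eventuallyEq ?_
    filter_upwards [isOpen_ne.mem_nhds hx.2] with y hy
    rw [hdne y hy]
  have hder : ∀ x ∈ Ioo l u \ {p}, HasDerivAt w (h x) x := by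
    intro x hx
    rcases lt_or_gt_of_ne hx.2 with hxp | hxp
    · refine (hder0 x hx).congr_of_eventuallyEq ?_
      filter_upwards [Iio_mem_nhds hxp] with y hy using hwl y hy
    · refine ((hder0 x hx).add_const (2 * j)).congr_of_eventuallyEq ?_
      filter_upwards [Ioi_mem_nhds hxp] with y hy using hwr y hy
  have hwc : ContinuousOn w (Ioo l u) := by
    intro x hx
    refine ContinuousAt.continuousWithinAt ?_
    by_cases hxp : x = p
    · subst hxp
      have hφl : Tendsto (fun y => 2 * (φ y - c)) (𝓝 x) (𝓝 (2 * (φ x - c))) :=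
        ((hφ.sub continuous_const).const_mul 2).tendsto x
      rw [continuousAt_iff_continuous_left'_right']
      constructor
      · rw [ContinuousWithinAt, hwp]
        refine ((hφl.mono_left nhdsWithin_le_nhds).mul hsl).congr' ?_
        filter_upwards [self_mem_nhdsWithin] with y hy
        rw [hwl y hy, hdne y (ne_of_lt hy)]
      · rw [ContinuousWithinAt, hwp]
        have h1 := ((hφl.mono_left nhdsWithin_le_nhds).mul hsr).add_const (2 * j)
        rw [show 2 * (φ x - c) * -s + 2 * j = j by rw [hj]; ring] at h1
        refine h1.congr' ?_
        filter_upwards [self_mem_nhdsWithin] with y hy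
        rw [hwr y hy, hdne y (ne_of_gt hy)]
    · exact (hder x ⟨hx, hxp⟩).continuousAt
  have e2 := integral_mul_deriv_eq_neg_off_countable (f := w) (f' := h) (s := {p}) isOpen_Ioo
    (countable_singleton p) hwc hder hη hηc hηU hhi
  -- The weak equation says that the flux itself integrates by parts against `η`, and so does `w`.
  -- The difference, `2 * j` times the integral of `deriv η` over `Ioi p`, equals `-2 * j * η p`, so
  -- it must vanish; `η p = 1`.
  have e5 : ∫ x, w x * deriv η x =
      (∫ x, 2 * (φ x - c) * d x * deriv η x) + ∫ x in Ioi p, 2 * j * deriv η x := by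
    rw [← integral_indicator measurableSet_Ioi, ← integral_add]
    · refine integral_congr_ae ?_
      filter_upwards [compl_mem_ae_iff.2 (measure_singleton p)] with x hxp
      rcases lt_or_gt_of_ne (show x ≠ p from hxp) with hx | hx
      · simp [hwl x hx, not_lt.2 hx.le]
      · simp [hwr x hx, gt_iff_lt.1 hx]; ring
    · exact hcomp _ hη'.continuous hηc.deriv hηU' (fun x => 2 * (φ x - c)) (by fun_prop)
    · exact ((hη'.continuous.integrable_of_hasCompactSupport hηc.deriv).const_mul _).indicator
        measurableSet_Ioi
  rw [integral_const_mul, hηc.integral_Ioi_deriv_eq (hη.of_le (by simp)), hηp] at e5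
  have hj0 : j = 0 := by linarith
  rw [hj] at hj0
  have : φ p - c = 0 := by simpa [hs0] using hj0
  linarith

/-! ### Pointwise description of a peakon -/

/-- The pointwise properties of a peakon with speed `c` and constant of integration `a`. -/
structure IsPeakonProfile (c a : ℝ) (φ : ℝ → ℝ) : Prop where
  continuous : Continuous φ
  smoothNear_or_hasPeakAt : ∀ x, SmoothNear φ x ∨ HasPeakAt φ x
  eq_speed_of_hasPeakAt : ∀ x, HasPeakAt φ x → φ x = c
  equation : ∀ x, SmoothNear φ x →
    deriv φ x ^ 2 + 2 * (φ x - c) * deriv (deriv φ) x = 2 * φ x ^ 3 - 2 * c * φ x - a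

theorem IsPeakon.exists_profile {c : ℝ} {φ : ℝ → ℝ} (h : IsPeakon c φ) :
    ∃ a, IsPeakonProfile c a φ := by
  obtain ⟨⟨hφ, g, hg, a, hw⟩, -, hd⟩ := h
  refine ⟨a, hφ, hd, fun x hx => eq_speed_of_hasPeakAt hφ hg hw hx, ?_⟩
  rintro x ⟨ε, hε, hs⟩
  exact pointwise_equation hφ hg hw isOpen_Ioo hs ⟨by linarith, by linarith⟩

theorem SmoothNear.contDiffAt {φ : ℝ → ℝ} {x : ℝ} (h : SmoothNear φ x) : ContDiffAt ℝ ∞ φ x := by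
  obtain ⟨ε, hε, hs⟩ := h
  exact hs.contDiffAt (Ioo_mem_nhds (by linarith) (by linarith))

theorem SmoothNear.hasDerivAt {φ : ℝ → ℝ} {x : ℝ} (h : SmoothNear φ x) :
    HasDerivAt φ (deriv φ x) x :=
  (h.contDiffAt.differentiableAt (by simp)).hasDerivAt

theorem SmoothNear.hasDerivAt_deriv {φ : ℝ → ℝ} {x : ℝ} (h : SmoothNear φ x) :
    HasDerivAt (deriv φ) (deriv (deriv φ) x) x := by
  obtain ⟨ε, hε, hs⟩ := h
  exact ((contDiffOn_infty_iff_deriv_of_isOpen isOpen_Ioo).1 hs).2.hasDerivAt_of_isOpen isOpen_Ioo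
    ⟨by linarith, by linarith⟩

theorem tendsto_const_sub_nhdsLT (p x : ℝ) :
    Tendsto (fun y => p - y) (𝓝[<] x) (𝓝[>] (p - x)) := by
  refine tendsto_nhdsWithin_of_tendsto_nhds_of_eventually_within _ ?_ ?_
  · exact ((continuous_const.sub continuous_id).tendsto x).mono_left nhdsWithin_le_nhds
  · filter_upwards [self_mem_nhdsWithin] with y hy
    simp only [mem_Iio, mem_Ioi] at *; linarith

theorem tendsto_const_sub_nhdsGT (p x : ℝ) :
    Tendsto (fun y => p - y) (𝓝[>] x) (𝓝[<] (p - x)) := by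
  refine tendsto_nhdsWithin_of_tendsto_nhds_of_eventually_within _ ?_ ?_
  · exact ((continuous_const.sub continuous_id).tendsto x).mono_left nhdsWithin_le_nhds
  · filter_upwards [self_mem_nhdsWithin] with y hy
    simp only [mem_Iio, mem_Ioi] at *; linarith

theorem contDiffOn_comp_const_sub {φ : ℝ → ℝ} {l u : ℝ} (p : ℝ)
    (h : ContDiffOn ℝ ∞ φ (Ioo (p - u) (p - l))) :
    ContDiffOn ℝ ∞ (fun x => φ (p - x)) (Ioo l u) :=
  h.comp (contDiff_const.sub contDiff_id).contDiffOn
    fun x hx => ⟨by linarith [hx.2], by linarith [hx.1]⟩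

theorem SmoothNear.comp_const_sub {φ : ℝ → ℝ} {p x : ℝ} (h : SmoothNear φ (p - x)) :
    SmoothNear (fun y => φ (p - y)) x := by
  obtain ⟨ε, hε, hs⟩ := h
  exact ⟨ε, hε, contDiffOn_comp_const_sub p (by convert hs using 2 <;> ring)⟩

theorem HasPeakAt.comp_const_sub {φ : ℝ → ℝ} {p x : ℝ} (h : HasPeakAt φ (p - x)) :
    HasPeakAt (fun y => φ (p - y)) x := by
  obtain ⟨hc, ⟨ε, hε, hl, hr⟩, s, hs, hsl, hsr⟩ := h
  have hd : deriv (fun y => φ (p - y)) = fun y => - deriv φ (p - y) := by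
    ext y; exact deriv_comp_const_sub φ p y
  refine ⟨?_, ⟨ε, hε, ?_, ?_⟩, s, hs, ?_, ?_⟩
  · exact ContinuousAt.comp (f := fun y => p - y) (g := φ) hc
      (continuous_const.sub continuous_id).continuousAt
  · exact contDiffOn_comp_const_sub p (by convert hr using 2; ring)
  · exact contDiffOn_comp_const_sub p (by convert hl using 2; ring)
  · rw [hd]
    simpa using (hsr.comp (tendsto_const_sub_nhdsLT p x)).neg
  · rw [hd]
    exact (hsl.comp (tendsto_const_sub_nhdsGT p x)).neg

/-- The equation contains `φ'` only squared, so it is invariant under reflection. This reduces the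
left side of a crest to the right side; two reflections make a translation. -/
theorem IsPeakonProfile.comp_const_sub {c a : ℝ} {φ : ℝ → ℝ} (h : IsPeakonProfile c a φ) (p : ℝ) :
    IsPeakonProfile c a (fun x => φ (p - x)) := by
  have hd : deriv (fun y => φ (p - y)) = fun y => - deriv φ (p - y) := by
    ext y; exact deriv_comp_const_sub φ p y
  have hinv : (fun x => φ (p - (p - x))) = φ := by ext; simp
  refine ⟨h.continuous.comp (continuous_const.sub continuous_id), fun x => ?_, fun x hx => ?_,
    fun x hx => ?_⟩
  · exact (h.smoothNear_or_hasPeakAt (p - x)).imp (·.comp_const_sub) (·.comp_const_sub)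
  · refine h.eq_speed_of_hasPeakAt _ ?_
    have := HasPeakAt.comp_const_sub (p := p) (x := p - x) (φ := fun y => φ (p - y))
      (by simpa using hx)
    rwa [hinv] at this
  · have hs : SmoothNear φ (p - x) := by
      have := SmoothNear.comp_const_sub (p := p) (x := p - x) (φ := fun y => φ (p - y))
        (by simpa using hx)
      rwa [hinv] at this
    have := h.equation _ hs
    rw [hd, deriv.fun_neg, deriv_comp_const_sub]
    simpa using this

theorem IsPeakonProfile.comp_const_add {c a : ℝ} {φ : ℝ → ℝ} (h : IsPeakonProfile c a φ) (p : ℝ) :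
    IsPeakonProfile c a (fun x => φ (p + x)) := by
  have := (h.comp_const_sub p).comp_const_sub 0
  simpa using this

theorem IsPeakonProfile.smoothNear {c a : ℝ} {φ : ℝ → ℝ} (h : IsPeakonProfile c a φ) {x : ℝ}
    (hx : φ x ≠ c) : SmoothNear φ x :=
  (h.smoothNear_or_hasPeakAt x).resolve_right fun h' => hx (h.eq_speed_of_hasPeakAt x h')

/-! ### Uniqueness for autonomous second order equations -/

/-- `f` solves `f'' = G(f)` on `[p, q)` with `f p = v`, right slope `s` at `p`, and values in
`[lo, hi]`. -/
structure SolvesFrom (G : ℝ → ℝ) (p q v s lo hi : ℝ) (f : ℝ → ℝ) : Prop where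
  continuousOn : ContinuousOn f (Ico p q)
  initial : f p = v
  hasDerivAt : ∀ x ∈ Ioo p q, HasDerivAt f (deriv f x) x
  hasDerivAt_deriv : ∀ x ∈ Ioo p q, HasDerivAt (deriv f) (G (f x)) x
  slope : Tendsto (deriv f) (𝓝[>] p) (𝓝 s)
  mem : ∀ x ∈ Ico p q, f x ∈ Icc lo hi

/-- The first order system for `(f, f')`. At a peak `deriv f p` is not the right slope, so the
second component is set to `s` at `p`; the right derivatives there come from the limits of the
derivatives. -/
theorem SolvesFrom.hasDerivWithinAt {G : ℝ → ℝ} {p q v s lo hi : ℝ} {f : ℝ → ℝ}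
    (h : SolvesFrom G p q v s lo hi f) (hG : Continuous G) {x : ℝ} (hx : x ∈ Ico p q) :
    HasDerivWithinAt (fun t => (f t, Function.update (deriv f) p s t))
      (Function.update (deriv f) p s x, G (f x)) (Ici x) x := by
  have hpq : p < q := hx.1.trans_lt hx.2
  have hmem : Ioo p q ∈ 𝓝[>] p := Ioo_mem_nhdsGT hpq
  rcases hx.1.eq_or_lt with rfl | hpx
  · have hcw : ContinuousWithinAt f (Ioo p q) p :=
      (h.continuousOn p ⟨le_rfl, hpq⟩).mono Ioo_subset_Ico_self
    have hcp : Tendsto f (𝓝[>] p) (𝓝 (f p)) :=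
      hcw.mono_of_mem_nhdsWithin hmem
    refine HasDerivWithinAt.prodMk ?_ ?_
    · rw [Function.update_self]
      exact hasDerivWithinAt_Ici_of_tendsto_deriv
        (fun x hx => (h.hasDerivAt x hx).differentiableAt.differentiableWithinAt) hcw hmem h.slope
    · have hev : ∀ x ∈ Ioo p q, Function.update (deriv f) p s =ᶠ[𝓝 x] deriv f := fun x hx => by
        filter_upwards [Ioi_mem_nhds hx.1] with y hy
        rw [Function.update_of_ne (ne_of_gt hy)]
      have hder : ∀ x ∈ Ioo p q, HasDerivAt (Function.update (deriv f) p s) (G (f x)) x :=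
        fun x hx => (h.hasDerivAt_deriv x hx).congr_of_eventuallyEq (hev x hx)
      refine hasDerivWithinAt_Ici_of_tendsto_deriv
        (fun x hx => (hder x hx).differentiableAt.differentiableWithinAt) ?_ hmem ?_
      · rw [ContinuousWithinAt, Function.update_self]
        refine ((h.slope.mono_left (nhdsWithin_mono p Ioo_subset_Ioi_self))).congr' ?_
        filter_upwards [self_mem_nhdsWithin] with y hy
        rw [Function.update_of_ne (ne_of_gt hy.1)]
      · refine ((hG.tendsto (f p)).comp hcp).congr' ?_
        filter_upwards [hmem] with y hy
        exact (hder y hy).deriv.symm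
  · have hx' : x ∈ Ioo p q := ⟨hpx, hx.2⟩
    refine HasDerivAt.hasDerivWithinAt (HasDerivAt.prodMk ?_ ?_)
    · rw [Function.update_of_ne hpx.ne']; exact h.hasDerivAt x hx'
    · refine (h.hasDerivAt_deriv x hx').congr_of_eventuallyEq ?_
      filter_upwards [Ioi_mem_nhds hpx] with y hy
      rw [Function.update_of_ne (ne_of_gt hy)]

theorem SolvesFrom.continuousOn_prod {G : ℝ → ℝ} {p q v s lo hi : ℝ} {f : ℝ → ℝ}
    (h : SolvesFrom G p q v s lo hi f) {x : ℝ} (hx : x ∈ Ico p q) :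
    ContinuousOn (fun t => (f t, Function.update (deriv f) p s t)) (Icc p x) := by
  refine (h.continuousOn.mono (Icc_subset_Ico_right hx.2)).prodMk fun t ht => ?_
  rcases ht.1.eq_or_lt with rfl | hpt
  · rw [continuousWithinAt_update_same]
    exact h.slope.mono_left (nhdsWithin_mono p fun y hy => lt_of_le_of_ne hy.1.1 (Ne.symm hy.2))
  · refine ContinuousAt.continuousWithinAt ?_
    refine (h.hasDerivAt_deriv t ⟨hpt, ht.2.trans_lt hx.2⟩).continuousAt.congr ?_
    filter_upwards [Ioi_mem_nhds hpt] with y hy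
    rw [Function.update_of_ne (ne_of_gt hy)]

/-- Grönwall uniqueness. `G` need not be globally Lipschitz, but it is on the compact range `[lo,
hi]` that contains the values of both solutions. -/
theorem SolvesFrom.eqOn {G : ℝ → ℝ} {p q v s lo hi : ℝ} {f g : ℝ → ℝ}
    (hf : SolvesFrom G p q v s lo hi f) (hg : SolvesFrom G p q v s lo hi g)
    (hG : ContDiff ℝ 1 G) : EqOn f g (Ico p q) := by
  intro x hx
  obtain ⟨K, hK⟩ := (hG.contDiffOn (s := Icc lo hi)).exists_lipschitzOnWith one_ne_zero
    (convex_Icc lo hi) isCompact_Icc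
  have hv : LipschitzOnWith (max 1 (K * 1)) (fun P : ℝ × ℝ => (P.2, G P.1))
      (Icc lo hi ×ˢ univ) :=
    (LipschitzWith.prod_snd.lipschitzOnWith).prodMk
      (hK.comp LipschitzWith.prod_fst.lipschitzOnWith fun P hP => hP.1)
  have := ODE_solution_unique_of_mem_Icc_right (v := fun _ P => (P.2, G P.1))
    (s := fun _ => Icc lo hi ×ˢ univ) (fun _ _ => hv) (hf.continuousOn_prod hx)
    (fun t ht => hf.hasDerivWithinAt hG.continuous ⟨ht.1, ht.2.trans hx.2⟩)
    (fun t ht => ⟨hf.mem t ⟨ht.1, ht.2.trans hx.2⟩, mem_univ _⟩)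
    (hg.continuousOn_prod hx)
    (fun t ht => hg.hasDerivWithinAt hG.continuous ⟨ht.1, ht.2.trans hx.2⟩)
    (fun t ht => ⟨hg.mem t ⟨ht.1, ht.2.trans hx.2⟩, mem_univ _⟩)
    (by simp [hf.initial, hg.initial]) (right_mem_Icc.2 hx.1)
  exact congrArg Prod.fst this

/-! ### First integral -/

/-- The quartic whose values are compared in the first integral. -/
noncomputable def profileQuartic (c a y : ℝ) : ℝ := y ^ 4 / 2 - c * y ^ 2 - a * y

theorem IsPeakonProfile.exists_slope_right {c a : ℝ} {f : ℝ → ℝ} (h : IsPeakonProfile c a f)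
    (p : ℝ) : ∃ s, Tendsto (deriv f) (𝓝[>] p) (𝓝 s) := by
  rcases h.smoothNear_or_hasPeakAt p with hp | ⟨-, -, s, -, -, hs⟩
  · exact ⟨_, hp.hasDerivAt_deriv.continuousAt.tendsto.mono_left nhdsWithin_le_nhds⟩
  · exact ⟨_, hs⟩

/-- The equation times `f'` says that `(f - c) f'² - Q(f)` has zero derivative away from height `c`.
At a crest the first term tends to `0`, because one-sided slopes are finite. -/
theorem IsPeakonProfile.first_integral {c a : ℝ} {f : ℝ → ℝ} (h : IsPeakonProfile c a f)
    {x₀ x : ℝ} (h0 : f x₀ = c) (hx₀ : x₀ < x) (hx : f x ≠ c) :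
    (f x - c) * deriv f x ^ 2 = profileQuartic c a (f x) - profileQuartic c a c := by
  have hK : IsCompact (Icc x₀ x ∩ f ⁻¹' {c}) :=
    isCompact_Icc.inter_right (isClosed_singleton.preimage h.continuous)
  -- Starting from the last point before `x` at height `c` keeps the profile smooth on `(p, x]`.
  obtain ⟨p, ⟨hpI, hpc⟩, hpm⟩ := hK.exists_isGreatest ⟨x₀, ⟨le_rfl, hx₀.le⟩, h0⟩
  have hpx : p < x := lt_of_le_of_ne hpI.2 fun e => hx (e ▸ hpc)
  have hne : ∀ y ∈ Ioc p x, f y ≠ c := fun y hy hyc =>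
    not_lt.2 (hpm ⟨⟨hpI.1.trans hy.1.le, hy.2⟩, hyc⟩) hy.1
  set E : ℝ → ℝ := fun y => (f y - c) * deriv f y ^ 2 - profileQuartic c a (f y) with hE
  have hder : ∀ y ∈ Ioc p x, HasDerivAt E 0 y := by
    intro y hy
    have hs := h.smoothNear (hne y hy)
    have hf := hs.hasDerivAt
    have h1 := ((hf.sub_const c).mul (hs.hasDerivAt_deriv.fun_pow 2)).sub
      ((((hf.fun_pow 4).div_const 2).sub ((hf.fun_pow 2).const_mul c)).sub (hf.const_mul a))
    refine h1.congr_deriv ?_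
    have h2 := h.equation y hs
    simp only [Nat.cast_ofNat]
    linear_combination deriv f y * h2
  obtain ⟨s, hs⟩ := h.exists_slope_right p
  have hlim : Tendsto E (𝓝[>] p) (𝓝 ((c - c) * s ^ 2 - profileQuartic c a c)) := by
    have hf : Tendsto f (𝓝[>] p) (𝓝 c) := by
      have := (h.continuous.tendsto p).mono_left (nhdsWithin_le_nhds (s := Ioi p))
      rwa [show f p = c from hpc] at this
    refine ((hf.sub_const c).mul (hs.pow 2)).sub ?_
    exact (((hf.pow 4).div_const 2).sub ((hf.pow 2).const_mul c)).sub (hf.const_mul a)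
  have hconst : ∀ᶠ y in 𝓝[>] p, E x = E y := by
    filter_upwards [Ioo_mem_nhdsGT hpx] with y hy
    exact constant_of_has_deriv_right_zero
      (fun t ht => (hder t ⟨hy.1.trans_le ht.1, ht.2⟩).continuousAt.continuousWithinAt)
      (fun t ht => (hder t ⟨hy.1.trans_le ht.1, ht.2.le⟩).hasDerivWithinAt) x ⟨hy.2.le, le_rfl⟩
  have := tendsto_nhds_unique (tendsto_const_nhds.congr' hconst) hlim
  simp only [hE] at this
  linarith

/-! ### The reduced equation -/

/-- The cubic in `(φ')² = (φ - m)(φ - r)(φ - z) / 2`. -/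
noncomputable def profileCubic (m r z y : ℝ) : ℝ := (y - m) * (y - r) * (y - z) / 2

/-- Half of the derivative of `profileCubic`, the right hand side of the second order equation. -/
noncomputable def profileForce (m r z y : ℝ) : ℝ :=
  ((y - r) * (y - z) + (y - m) * (y - z) + (y - m) * (y - r)) / 4

/-- The constant of integration belonging to the roots `m`, `r`, `z`. -/
noncomputable def profileConstant (m r z c : ℝ) : ℝ :=
  (m * r * c + m * r * z + m * c * z + r * c * z) / 2

/-- The relations between the roots and the speed. -/
structure IsRootRelation (m r z c : ℝ) : Prop where
  sum_eq : z = -m - r - c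
  ellipsoid : r ^ 2 + m ^ 2 + c ^ 2 + r * m + r * c + m * c - 2 * c = 0

/-- Vieta: `sum_eq` kills the cubic coefficient, `ellipsoid` fixes the quadratic one, and the
constant is half the third elementary symmetric polynomial of the roots. -/
theorem IsRootRelation.quartic_sub {m r z c : ℝ} (h : IsRootRelation m r z c) (y : ℝ) :
    profileQuartic c (profileConstant m r z c) y - profileQuartic c (profileConstant m r z c) c =
      (y - c) * profileCubic m r z y := by
  obtain ⟨rfl, h⟩ := h
  simp only [profileQuartic, profileConstant, profileCubic]
  linear_combination (y ^ 2 / 2 - c ^ 2 / 2) * h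

/-- The derivative in `y` of the factorization `quartic_sub`. -/
theorem IsRootRelation.force {m r z c : ℝ} (h : IsRootRelation m r z c) (y : ℝ) :
    2 * y ^ 3 - 2 * c * y - profileConstant m r z c =
      profileCubic m r z y + 2 * (y - c) * profileForce m r z y := by
  obtain ⟨rfl, h⟩ := h
  simp only [profileForce, profileConstant, profileCubic]
  linear_combination y * h

/-- The condition is affine in `a`, with slope `c - m ≠ 0`. -/
theorem IsRootRelation.constant_eq {m r z c a : ℝ} (h : IsRootRelation m r z c) (hmc : m ≠ c)
    (ha : profileQuartic c a m = profileQuartic c a c) : a = profileConstant m r z c := by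
  have h1 := h.quartic_sub m
  have h2 : profileCubic m r z m = 0 := by simp [profileCubic]
  rw [h2] at h1
  simp only [profileQuartic] at h1 ha
  have : (a - profileConstant m r z c) * (m - c) = 0 := by linear_combination h1 - ha
  rcases mul_eq_zero.1 this with h | h
  · linarith
  · exact absurd (by linarith) hmc

/-- Slope of a profile immediately to the right of a crest. -/
theorem IsPeakonProfile.slope_right_of_crest {m r z c : ℝ} {f : ℝ → ℝ}
    (h : IsPeakonProfile c (profileConstant m r z c) f) (hrel : IsRootRelation m r z c)
    (hpos : 0 < profileCubic m r z c) (hle : ∀ x, f x ≤ c) {p : ℝ} (hp : f p = c) :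
    Tendsto (deriv f) (𝓝[>] p) (𝓝 (-√(profileCubic m r z c))) ∧ ∀ᶠ x in 𝓝[>] p, f x < c := by
  -- At a smooth maximum of height `c` the left side of the equation vanishes, while the right side
  -- is `profileCubic m r z c > 0`.
  have hpk : HasPeakAt f p := by
    refine (h.smoothNear_or_hasPeakAt p).resolve_left fun hs => ?_
    have hmax : IsLocalMax f p := Eventually.of_forall fun x => hp ▸ hle x
    have h1 := h.equation p hs
    rw [hmax.deriv_eq_zero, hrel.force, hp] at h1
    simp at h1
    exact hpos.ne h1
  obtain ⟨-, ⟨ε, hε, -, hr⟩, s, hs0, -, hs⟩ := hpk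
  have hmvt : ∀ q > p, q < p + ε → ∃ t ∈ Ioo p q, f q - c = deriv f t * (q - p) := by
    intro q hq hqε
    obtain ⟨t, ht, hts⟩ := exists_deriv_eq_slope f hq h.continuous.continuousOn
      ((hr.differentiableOn (by simp)).mono fun x hx => ⟨hx.1, hx.2.trans hqε⟩)
    refine ⟨t, ht, ?_⟩
    rw [hts, hp]
    field_simp [sub_ne_zero.2 hq.ne']
  -- A negative `s` would make `f` increase beyond its maximum `c` to the right of `p`.
  have hspos : 0 < s := by
    by_contra hn
    have hs' : s < 0 := lt_of_le_of_ne (not_lt.1 hn) hs0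
    obtain ⟨u, hu, hu'⟩ := mem_nhdsGT_iff_exists_Ioo_subset.1
      (hs.eventually (lt_mem_nhds (show 0 < -s by linarith)))
    obtain ⟨q, hq1, hq2⟩ := exists_between (lt_min hu (show p < p + ε by linarith))
    obtain ⟨t, ht, hte⟩ := hmvt q hq1 (hq2.trans_le (min_le_right _ _))
    have : 0 < deriv f t := hu' ⟨ht.1, ht.2.trans (hq2.trans_le (min_le_left _ _))⟩
    nlinarith [hle q, mul_pos this (show 0 < q - p by linarith)]
  have hlt : ∀ᶠ x in 𝓝[>] p, f x < c := by
    obtain ⟨u, hu, hu'⟩ := mem_nhdsGT_iff_exists_Ioo_subset.1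
      (hs.eventually (gt_mem_nhds (show -s < 0 by linarith)))
    filter_upwards [Ioo_mem_nhdsGT (lt_min hu (show p < p + ε by linarith))] with q hq
    obtain ⟨t, ht, hte⟩ := hmvt q hq.1 (hq.2.trans_le (min_le_right _ _))
    have : deriv f t < 0 := hu' ⟨ht.1, ht.2.trans (hq.2.trans_le (min_le_left _ _))⟩
    nlinarith [mul_pos (neg_pos.2 this) (show 0 < q - p by linarith [hq.1])]
  have hsq : s ^ 2 = profileCubic m r z c := by
    have h1 : Tendsto (fun x => deriv f x ^ 2) (𝓝[>] p) (𝓝 ((-s) ^ 2)) := hs.pow 2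
    have h2 : Tendsto (fun x => profileCubic m r z (f x)) (𝓝[>] p)
        (𝓝 (profileCubic m r z c)) := by
      have hc : Continuous fun x => profileCubic m r z (f x) := by
        have := h.continuous
        unfold profileCubic; fun_prop
      have := (hc.tendsto p).mono_left (nhdsWithin_le_nhds (s := Ioi p))
      rwa [hp] at this
    have h3 : (fun x => deriv f x ^ 2) =ᶠ[𝓝[>] p] fun x => profileCubic m r z (f x) := by
      filter_upwards [hlt, self_mem_nhdsWithin] with x hx hpx
      have := h.first_integral hp hpx hx.ne
      rw [hrel.quartic_sub] at this
      exact mul_left_cancel₀ (sub_ne_zero.2 hx.ne) this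
    have := tendsto_nhds_unique (h1.congr' h3) h2
    rwa [neg_sq] at this
  refine ⟨?_, hlt⟩
  rwa [← hsq, Real.sqrt_sq hspos.le]

/-- `W` is the profile to the right of a crest at `0`, on an interval of length `ℓ`. -/
structure IsPeakonArc (m r z c ℓ : ℝ) (W : ℝ → ℝ) : Prop where
  continuousOn : ContinuousOn W (Icc 0 ℓ)
  crest : W 0 = c
  contDiffOn : ∃ ε > 0, ContDiffOn ℝ ∞ W (Ioo (-ε) ℓ)
  mem : ∀ x ∈ Ioo 0 ℓ, m ≤ W x ∧ W x < c
  deriv_crest : deriv W 0 = -√(profileCubic m r z c)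
  deriv_sq : ∀ x ∈ Ioo 0 ℓ, deriv W x ^ 2 = profileCubic m r z (W x)
  deriv_deriv : ∀ x ∈ Ioo 0 ℓ, deriv (deriv W) x = profileForce m r z (W x)

theorem IsPeakonArc.tendsto_deriv {m r z c ℓ : ℝ} {W : ℝ → ℝ} (h : IsPeakonArc m r z c ℓ W)
    (hℓ : 0 < ℓ) : Tendsto (deriv W) (𝓝[>] 0) (𝓝 (-√(profileCubic m r z c))) := by
  obtain ⟨ε, hε, hs⟩ := h.contDiffOn
  have h0 : (0 : ℝ) ∈ Ioo (-ε) ℓ := ⟨by linarith, hℓ⟩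
  rw [← h.deriv_crest]
  exact ((hs.continuousOn_deriv_of_isOpen isOpen_Ioo (by simp)).continuousAt
    (isOpen_Ioo.mem_nhds h0)).tendsto.mono_left nhdsWithin_le_nhds

theorem IsPeakonArc.solvesFrom {m r z c ℓ q : ℝ} {W : ℝ → ℝ} (h : IsPeakonArc m r z c ℓ W)
    (hmc : m ≤ c) (hq0 : 0 < q) (hq : q ≤ ℓ) :
    SolvesFrom (profileForce m r z) 0 q c (-√(profileCubic m r z c)) m c W := by
  have hslope := h.tendsto_deriv (hq0.trans_le hq)
  obtain ⟨ε, hε, hs⟩ := h.contDiffOn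
  have hs1 := ((contDiffOn_infty_iff_deriv_of_isOpen isOpen_Ioo).1 hs).2
  have hmem : ∀ x ∈ Ioo 0 q, x ∈ Ioo (-ε) ℓ := fun x hx => ⟨by linarith [hx.1], hx.2.trans_le hq⟩
  refine ⟨h.continuousOn.mono fun x hx => ⟨hx.1, hx.2.le.trans hq⟩, h.crest,
    fun x hx => hs.hasDerivAt_of_isOpen isOpen_Ioo (hmem x hx), fun x hx => ?_, hslope,
    fun x hx => ?_⟩
  · rw [← h.deriv_deriv x ⟨hx.1, hx.2.trans_le hq⟩]
    exact hs1.hasDerivAt_of_isOpen isOpen_Ioo (hmem x hx)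
  · rcases hx.1.eq_or_lt with rfl | h0
    · rw [h.crest]; exact ⟨hmc, le_rfl⟩
    · have := h.mem x ⟨h0, hx.2.trans_le hq⟩
      exact ⟨this.1, this.2.le⟩

theorem IsPeakonProfile.solvesFrom {m r z c q : ℝ} {f : ℝ → ℝ}
    (h : IsPeakonProfile c (profileConstant m r z c) f) (hrel : IsRootRelation m r z c)
    (hpos : 0 < profileCubic m r z c) (hmem : ∀ x, f x ∈ Icc m c) (h0 : f 0 = c)
    (hlt : ∀ x ∈ Ioo 0 q, f x < c) :
    SolvesFrom (profileForce m r z) 0 q c (-√(profileCubic m r z c)) m c f := by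
  have hsm : ∀ x ∈ Ioo 0 q, SmoothNear f x := fun x hx => h.smoothNear (hlt x hx).ne
  refine ⟨h.continuous.continuousOn, h0, fun x hx => (hsm x hx).hasDerivAt, fun x hx => ?_,
    (h.slope_right_of_crest hrel hpos (fun x => (hmem x).2) h0).1, fun x _ => hmem x⟩
  have hne := sub_ne_zero.2 (hlt x hx).ne
  have h1 := h.equation x (hsm x hx)
  have h2 := h.first_integral h0 hx.1 (hlt x hx).ne
  rw [hrel.quartic_sub] at h2
  replace h2 := mul_left_cancel₀ hne h2
  rw [hrel.force, h2] at h1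
  have h3 : deriv (deriv f) x = profileForce m r z (f x) :=
    mul_left_cancel₀ (mul_ne_zero two_ne_zero hne) (by linarith)
  rw [← h3]
  exact (hsm x hx).hasDerivAt_deriv

/-- To the right of a crest, a profile is the model arc. -/
theorem IsPeakonProfile.eqOn_arc {m r z c ℓ : ℝ} {f W : ℝ → ℝ}
    (h : IsPeakonProfile c (profileConstant m r z c) f) (hrel : IsRootRelation m r z c)
    (hpos : 0 < profileCubic m r z c) (hmem : ∀ x, f x ∈ Icc m c) (h0 : f 0 = c)
    (hW : IsPeakonArc m r z c ℓ W) (hℓ : 0 < ℓ) : EqOn f W (Icc 0 ℓ) := by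
  have hmc : m ≤ c := (hmem 0).1.trans (hmem 0).2
  have hG : ContDiff ℝ 1 (profileForce m r z) := by unfold profileForce; fun_prop
  -- As long as `f` stays below `c` the second order equation is available, and uniqueness applies.
  have step : ∀ q, 0 < q → q ≤ ℓ → (∀ x ∈ Ioo 0 q, f x < c) → EqOn f W (Icc 0 q) := by
    intro q hq0 hq hlt
    refine ((h.solvesFrom hrel hpos hmem h0 hlt).eqOn (hW.solvesFrom hmc hq0 hq) hG).of_subset_closure
      h.continuous.continuousOn (hW.continuousOn.mono (Icc_subset_Icc_right hq))
      Ico_subset_Icc_self ?_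
    rw [closure_Ico hq0.ne]
  refine step ℓ hℓ le_rfl ?_
  by_contra hcon
  push Not at hcon
  obtain ⟨β, hβ, hβc⟩ := hcon
  replace hβc : f β = c := le_antisymm (hmem β).2 hβc
  obtain ⟨δ, hδ, hδ'⟩ := mem_nhdsGT_iff_exists_Ioo_subset.1
    (h.slope_right_of_crest hrel hpos (fun x => (hmem x).2) h0).2
  simp only [mem_Ioi] at hδ
  have hδβ : δ ≤ β := by
    by_contra hlt
    exact (hδ' ⟨hβ.1, not_le.1 hlt⟩ : f β < c).ne hβc
  have hK : IsCompact (Icc δ β ∩ f ⁻¹' {c}) :=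
    isCompact_Icc.inter_right (isClosed_singleton.preimage h.continuous)
  -- The first return to `c`; it exists because `f < c` on `(0, δ)`. Agreement up to `b` then forces
  -- `W b = c` inside the arc, where `W < c`.
  obtain ⟨b, ⟨hbI, hbc⟩, hbm⟩ := hK.exists_isLeast ⟨β, ⟨hδβ, le_rfl⟩, hβc⟩
  have hb0 : 0 < b := hδ.trans_le hbI.1
  have hbℓ : b < ℓ := hbI.2.trans_lt hβ.2
  have hlt : ∀ x ∈ Ioo 0 b, f x < c := by
    intro x hx
    rcases lt_or_ge x δ with hxδ | hxδ
    · exact hδ' ⟨hx.1, hxδ⟩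
    · exact lt_of_le_of_ne (hmem x).2 fun e =>
        not_lt.2 (hbm ⟨⟨hxδ, hx.2.le.trans hbI.2⟩, e⟩) hx.2
  have := step b hb0 hbℓ.le hlt ⟨hb0.le, le_rfl⟩
  rw [show f b = c from hbc] at this
  exact (hW.mem b ⟨hb0, hbℓ⟩).2.ne this.symm

theorem IsPeakonProfile.eq_arc_abs {m r z c ℓ : ℝ} {f W : ℝ → ℝ}
    (h : IsPeakonProfile c (profileConstant m r z c) f) (hrel : IsRootRelation m r z c)
    (hpos : 0 < profileCubic m r z c) (hmem : ∀ x, f x ∈ Icc m c) {p : ℝ} (hp : f p = c)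
    (hW : IsPeakonArc m r z c ℓ W) (hℓ : 0 < ℓ) {x : ℝ} (hx : |x - p| ≤ ℓ) :
    f x = W |x - p| := by
  rcases le_total p x with hpx | hpx
  · have := (h.comp_const_add p).eqOn_arc hrel hpos (fun _ => hmem _) (by simpa using hp) hW hℓ
      ⟨abs_nonneg _, hx⟩
    rw [← this, abs_of_nonneg (by linarith)]
    simp
  · have := (h.comp_const_sub p).eqOn_arc hrel hpos (fun _ => hmem _) (by simpa using hp) hW hℓ
      ⟨abs_nonneg _, hx⟩
    rw [← this, abs_of_nonpos (by linarith)]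
    simp

/-! ### Gluing arcs yields a peakon -/

theorem IsCompact.exists_bound_of_locally_bounded {d : ℝ → ℝ} {K : Set ℝ} (hK : IsCompact K)
    (h : ∀ x, ∃ B, ∀ᶠ y in 𝓝 x, |d y| ≤ B) : ∃ B, ∀ x ∈ K, |d x| ≤ B := by
  refine hK.induction_on (p := fun s => ∃ B, ∀ x ∈ s, |d x| ≤ B) ⟨0, by simp⟩ ?_ ?_ ?_
  · rintro s t hst ⟨B, hB⟩
    exact ⟨B, fun x hx => hB x (hst hx)⟩
  · rintro s t ⟨B, hB⟩ ⟨B', hB'⟩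
    refine ⟨max B B', fun x hx => ?_⟩
    rcases hx with hx | hx
    · exact (hB x hx).trans (le_max_left _ _)
    · exact (hB' x hx).trans (le_max_right _ _)
  · intro x _
    obtain ⟨B, hB⟩ := h x
    exact ⟨_, mem_nhdsWithin_of_mem_nhds hB, B, fun y hy => hy⟩

theorem HasPeakAt.locally_bounded_deriv {φ : ℝ → ℝ} {x : ℝ} (h : HasPeakAt φ x) :
    ∃ B, ∀ᶠ y in 𝓝 x, |deriv φ y| ≤ B := by
  obtain ⟨-, -, s, -, hl, hr⟩ := h
  refine ⟨max (|s| + 1) |deriv φ x|, ?_⟩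
  have h1 := hl.abs.eventually (gt_mem_nhds (lt_add_one |s|))
  have h2 := hr.abs.eventually (gt_mem_nhds (by rw [abs_neg]; exact lt_add_one |s|))
  rw [eventually_nhdsWithin_iff] at h1 h2
  filter_upwards [h1, h2] with y hy1 hy2
  rcases lt_trichotomy y x with h | rfl | h
  · exact (hy1 h).le.trans (le_max_left _ _)
  · exact le_max_right _ _
  · exact (hy2 h).le.trans (le_max_left _ _)

theorem countable_of_isolated {S : Set ℝ} (hS : ∀ x ∈ S, ∀ᶠ y in 𝓝[≠] x, y ∉ S) :
    S.Countable := by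
  have hd : IsDiscrete S := by
    rw [isDiscrete_iff_nhdsNE]
    intro x hx
    have := (mem_iff_inf_principal_compl (f := 𝓝[≠] x) (s := Sᶜ)).1 (hS x hx)
    rwa [compl_compl] at this
  exact (HereditarilyLindelofSpace.isLindelof S).countable_of_isDiscrete hd

/-- A continuous function whose singularities are isolated peaks at height `c` and that solves the
differential equation elsewhere is a peakon. -/
theorem isPeakon_of_pointwise {c a : ℝ} {φ : ℝ → ℝ} (hφ : Continuous φ)
    (hs : ∀ x, φ x ≠ c → SmoothNear φ x ∧
      deriv φ x ^ 2 + 2 * (φ x - c) * deriv (deriv φ) x = 2 * φ x ^ 3 - 2 * c * φ x - a)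
    (hp : ∀ x, φ x = c → HasPeakAt φ x ∧ ∀ᶠ y in 𝓝[≠] x, φ y ≠ c) (hex : ∃ x, φ x = c) :
    IsPeakon c φ := by
  set S : Set ℝ := {x | φ x = c} with hS
  have hScount : S.Countable := countable_of_isolated fun x hx => (hp x hx).2
  have hb : ∀ x, ∃ B, ∀ᶠ y in 𝓝 x, |deriv φ y| ≤ B := by
    intro x
    by_cases hx : φ x = c
    · exact (hp x hx).1.locally_bounded_deriv
    · refine ⟨|deriv φ x| + 1, ?_⟩
      exact ((hs x hx).1.hasDerivAt_deriv.continuousAt.abs.eventually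
        (gt_mem_nhds (lt_add_one _))).mono fun y hy => hy.le
  have hm1 := measurable_deriv φ
  have hm0 := hφ.measurable
  have hd : ∀ x ∈ univ \ S, HasDerivAt φ (deriv φ x) x := fun x hx => (hs x hx.2).1.hasDerivAt
  have hint : ∀ η : ℝ → ℝ, Continuous η → HasCompactSupport η →
      ∀ f : ℝ → ℝ, Continuous f → Integrable fun x => f x * deriv φ x * η x := by
    intro η hη hc f hf
    obtain ⟨B, hB⟩ := hc.isCompact.exists_bound_of_locally_bounded hb
    have := integrable_mul_of_bounded_on_tsupport (f := deriv φ) (η := fun x => f x * η x)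
      hm1.aestronglyMeasurable (hf.mul hη) hc.mul_left
      (fun x hx => hB x (tsupport_mul_subset_right hx))
    exact this.congr (Eventually.of_forall fun x => by ring)
  have hint2 : ∀ η : ℝ → ℝ, Continuous η → HasCompactSupport η →
      Integrable fun x => deriv φ x ^ 2 * η x := by
    intro η hη hc
    obtain ⟨B, hB⟩ := hc.isCompact.exists_bound_of_locally_bounded hb
    refine integrable_mul_of_bounded_on_tsupport (K := B ^ 2)
      (hm1.pow_const 2).aestronglyMeasurable hη hc (fun x hx => ?_)
    rw [abs_pow]
    exact pow_le_pow_left₀ (abs_nonneg _) (hB x hx) 2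
  refine ⟨⟨hφ, deriv φ, ⟨fun K hK => ?_, fun η hη hc => ?_⟩, a, fun η hη hc => ?_⟩,
    hex.imp fun x hx => (hp x hx).1, fun x => ?_⟩
  · have : IsFiniteMeasure (volume.restrict K) := ⟨by simpa using hK.measure_lt_top⟩
    obtain ⟨B, hB⟩ := hK.exists_bound_of_locally_bounded hb
    refine MemLp.of_bound hm1.aestronglyMeasurable B ?_
    filter_upwards [ae_restrict_mem hK.measurableSet] with x hx using hB x hx
  · refine integral_mul_deriv_eq_neg_off_countable isOpen_univ hScount hφ.continuousOn hd hη hc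
      (subset_univ _) ?_
    simpa using hint η hη.continuous hc (fun _ => 1) continuous_const
  · have hη' : ContDiff ℝ ∞ (deriv η) := (contDiff_infty_iff_deriv.1 hη).2
    rw [show iteratedDeriv 2 η = deriv (deriv η) by rw [iteratedDeriv_succ, iteratedDeriv_one]]
    have e1 := integral_mul_deriv_eq_neg_off_countable (f := fun x => (φ x - c) ^ 2)
      (f' := fun x => 2 * (φ x - c) * deriv φ x) isOpen_univ hScount
      (by fun_prop) (fun x hx => hasDerivAt_sub_const_sq (hd x hx)) hη'
      hc.deriv (subset_univ _)
      (hint _ hη'.continuous hc.deriv (fun x => 2 * (φ x - c)) (by fun_prop))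
    set h : ℝ → ℝ := fun x => deriv φ x ^ 2 + (2 * φ x ^ 3 - 2 * c * φ x - a) with hh
    have hi0 : ∀ f : ℝ → ℝ, Continuous f → Integrable fun x => f x * η x := fun f hf =>
      integrable_mul_of_continuousOn_tsupport hf.aestronglyMeasurable hη.continuous hc
        hf.continuousOn
    have hhi : Integrable fun x => h x * η x :=
      ((hint2 η hη.continuous hc).add
        (hi0 (fun x => 2 * φ x ^ 3 - 2 * c * φ x - a) (by fun_prop))).congr
        (Eventually.of_forall fun x => by simp [hh]; ring)
    -- At a crest the bounded slope is multiplied by `φ - c → 0`, so the jump of `deriv φ`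
    -- disappears. This allows a second integration by parts without jump terms.
    have hcont : Continuous fun x => 2 * (φ x - c) * deriv φ x := by
      rw [continuous_iff_continuousAt]
      intro x
      by_cases hx : φ x = c
      · obtain ⟨B, hB⟩ := hb x
        have h1 : Tendsto (fun y => 2 * (φ y - c)) (𝓝 x) (𝓝 0) := by
          have := (by fun_prop : Continuous fun y => 2 * (φ y - c)).tendsto x
          simpa [hx] using this
        have h2 : Tendsto (fun y => 2 * (φ y - c) * deriv φ y) (𝓝 x) (𝓝 0) :=
          h1.zero_mul_isBoundedUnder_le ⟨B, by simpa using hB⟩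
        rw [ContinuousAt, hx]
        simpa using h2
      · exact ((continuousAt_const.mul (hφ.continuousAt.sub continuousAt_const))).mul
          (hs x hx).1.hasDerivAt_deriv.continuousAt
    have e2 := integral_mul_deriv_eq_neg_off_countable (f := fun x => 2 * (φ x - c) * deriv φ x)
      (f' := h) isOpen_univ hScount hcont.continuousOn (fun x hx => by
        refine (hasDerivAt_two_mul_sub_mul (hd x hx)
          (hs x hx.2).1.hasDerivAt_deriv).congr_deriv ?_
        simp only [hh]
        linarith [(hs x hx.2).2]) hη hc (subset_univ _) hhi
    rw [e1, e2, neg_neg, ← integral_const_mul, ← integral_add hhi (hi0 (fun _ => a) (by fun_prop))]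
    refine integral_congr_ae (Eventually.of_forall fun x => ?_)
    simp only [hh]; ring
  · by_cases hx : φ x = c
    · exact Or.inr (hp x hx).1
    · exact Or.inl (hs x hx).1

theorem smoothNear_of_contDiffOn {φ : ℝ → ℝ} {U : Set ℝ} (h : ContDiffOn ℝ ∞ φ U)
    (hU : IsOpen U) {x : ℝ} (hx : x ∈ U) : SmoothNear φ x := by
  obtain ⟨ε, hε, hb⟩ := Metric.isOpen_iff.1 hU x hx
  exact ⟨ε, hε, h.mono (by rwa [← Real.ball_eq_Ioo])⟩

/-- The crests `p` may vary from point to point, which covers both the periodic chain of arcs and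
the single crest of the solitary wave. -/
theorem isPeakon_of_locally_arc {m r z c : ℝ} {φ : ℝ → ℝ} (hrel : IsRootRelation m r z c)
    (hpos : 0 < profileCubic m r z c)
    (h : ∀ x, ∃ p ℓ W, |x - p| < ℓ ∧ IsPeakonArc m r z c ℓ W ∧
      ∀ y, |y - p| < ℓ → φ y = W |y - p|) : IsPeakon c φ := by
  -- behaviour on the two sides of a crest
  have right : ∀ {p ℓ W}, IsPeakonArc m r z c ℓ W → (∀ y, |y - p| < ℓ → φ y = W |y - p|) →
      ContDiffOn ℝ ∞ φ (Ioo p (p + ℓ)) ∧ ∀ y ∈ Ioo p (p + ℓ), φ y = W (y - p) ∧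
        deriv φ y = deriv W (y - p) ∧ deriv (deriv φ) y = deriv (deriv W) (y - p) := by
    intro p ℓ W hW hy
    have h0 : EqOn φ (fun y => W (y - p)) (Ioo p (p + ℓ)) := fun y hyI => by
      have h1 : |y - p| = y - p := abs_of_pos (by linarith [hyI.1])
      have := hy y (by rw [h1]; linarith [hyI.2])
      rwa [h1] at this
    have h1 : EqOn (deriv φ) (fun y => deriv W (y - p)) (Ioo p (p + ℓ)) := fun y hyI => by
      rw [h0.deriv isOpen_Ioo hyI, deriv_comp_sub_const]
    have h2 : EqOn (deriv (deriv φ)) (fun y => deriv (deriv W) (y - p)) (Ioo p (p + ℓ)) :=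
      fun y hyI => by rw [h1.deriv isOpen_Ioo hyI, deriv_comp_sub_const]
    refine ⟨?_, fun y hyI => ⟨h0 hyI, h1 hyI, h2 hyI⟩⟩
    obtain ⟨ε, hε, hs⟩ := hW.contDiffOn
    refine ContDiffOn.congr (hs.comp (contDiff_id.sub contDiff_const).contDiffOn
      fun y hyI => ?_) h0
    exact ⟨by simp only [id]; linarith [hyI.1], by simp only [id]; linarith [hyI.2]⟩
  have left : ∀ {p ℓ W}, IsPeakonArc m r z c ℓ W → (∀ y, |y - p| < ℓ → φ y = W |y - p|) →
      ContDiffOn ℝ ∞ φ (Ioo (p - ℓ) p) ∧ ∀ y ∈ Ioo (p - ℓ) p, φ y = W (p - y) ∧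
        deriv φ y = -deriv W (p - y) ∧ deriv (deriv φ) y = deriv (deriv W) (p - y) := by
    intro p ℓ W hW hy
    have h0 : EqOn φ (fun y => W (p - y)) (Ioo (p - ℓ) p) := fun y hyI => by
      have h1 : |y - p| = p - y := by rw [abs_of_neg (by linarith [hyI.2])]; ring
      have := hy y (by rw [h1]; linarith [hyI.1])
      rwa [h1] at this
    have h1 : EqOn (deriv φ) (fun y => -deriv W (p - y)) (Ioo (p - ℓ) p) := fun y hyI => by
      rw [h0.deriv isOpen_Ioo hyI, deriv_comp_const_sub]
    have h2 : EqOn (deriv (deriv φ)) (fun y => deriv (deriv W) (p - y)) (Ioo (p - ℓ) p) :=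
      fun y hyI => by
        rw [h1.deriv isOpen_Ioo hyI, deriv.fun_neg, deriv_comp_const_sub, neg_neg]
    refine ⟨?_, fun y hyI => ⟨h0 hyI, h1 hyI, h2 hyI⟩⟩
    obtain ⟨ε, hε, hs⟩ := hW.contDiffOn
    refine ContDiffOn.congr (contDiffOn_comp_const_sub p (hs.mono ?_)) h0
    exact Ioo_subset_Ioo (by linarith) (by linarith)
  have off : ∀ {p ℓ W x}, IsPeakonArc m r z c ℓ W → (∀ y, |y - p| < ℓ → φ y = W |y - p|) →
      |x - p| < ℓ → x ≠ p → φ x < c ∧ SmoothNear φ x ∧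
      deriv φ x ^ 2 + 2 * (φ x - c) * deriv (deriv φ) x =
        2 * φ x ^ 3 - 2 * c * φ x - profileConstant m r z c := by
    intro p ℓ W x hW hy hx hne
    have hx' := abs_lt.1 hx
    rw [hrel.force]
    rcases lt_or_gt_of_ne hne with hlt | hgt
    · obtain ⟨hs, he⟩ := left hW hy
      have hxI : x ∈ Ioo (p - ℓ) p := ⟨by linarith, hlt⟩
      have hxW : p - x ∈ Ioo 0 ℓ := ⟨by linarith, by linarith⟩
      obtain ⟨h0, h1, h2⟩ := he x hxI
      refine ⟨h0 ▸ (hW.mem _ hxW).2, smoothNear_of_contDiffOn hs isOpen_Ioo hxI, ?_⟩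
      rw [h0, h1, h2, neg_sq, hW.deriv_sq _ hxW, hW.deriv_deriv _ hxW]
    · obtain ⟨hs, he⟩ := right hW hy
      have hxI : x ∈ Ioo p (p + ℓ) := ⟨hgt, by linarith⟩
      have hxW : x - p ∈ Ioo 0 ℓ := ⟨by linarith, by linarith⟩
      obtain ⟨h0, h1, h2⟩ := he x hxI
      refine ⟨h0 ▸ (hW.mem _ hxW).2, smoothNear_of_contDiffOn hs isOpen_Ioo hxI, ?_⟩
      rw [h0, h1, h2, hW.deriv_sq _ hxW, hW.deriv_deriv _ hxW]
  have crest : ∀ {p ℓ W}, IsPeakonArc m r z c ℓ W → (∀ y, |y - p| < ℓ → φ y = W |y - p|) →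
      0 < ℓ → φ p = c := by
    intro p ℓ W hW hy hℓ
    rw [hy p (by simpa using hℓ), sub_self, abs_zero, hW.crest]
  have hcont : Continuous φ := by
    rw [continuous_iff_continuousAt]
    intro x
    obtain ⟨p, ℓ, W, hx, hW, hy⟩ := h x
    by_cases hxp : x = p
    · subst hxp
      have hℓ : 0 < ℓ := (abs_nonneg _).trans_lt hx
      obtain ⟨ε, hε, hs⟩ := hW.contDiffOn
      have hW0 : ContinuousAt W |x - x| := by
        rw [sub_self, abs_zero]
        exact (hs.contDiffAt (Ioo_mem_nhds (by linarith) hℓ)).continuousAt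
      have h1 : ContinuousAt (fun y => W |y - x|) x :=
        ContinuousAt.comp (f := fun y => |y - x|) (g := W) hW0 (by fun_prop)
      refine h1.congr ?_
      filter_upwards [Ioo_mem_nhds (show x - ℓ < x by linarith) (show x < x + ℓ by linarith)]
        with y hyI
      exact (hy y (abs_lt.2 ⟨by linarith [hyI.1], by linarith [hyI.2]⟩)).symm
    · exact (off hW hy hx hxp).2.1.contDiffAt.continuousAt
  refine isPeakon_of_pointwise (a := profileConstant m r z c) hcont (fun x hx => ?_)
    (fun x hx => ?_) ?_
  · obtain ⟨p, ℓ, W, hxp, hW, hy⟩ := h x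
    refine (off hW hy hxp ?_).2
    rintro rfl
    exact hx (crest hW hy ((abs_nonneg _).trans_lt hxp))
  · obtain ⟨p, ℓ, W, hxp, hW, hy⟩ := h x
    have hℓ : 0 < ℓ := (abs_nonneg _).trans_lt hxp
    obtain rfl : x = p := by
      by_contra hne
      exact (off hW hy hxp hne).1.ne hx
    have hslope := hW.tendsto_deriv hℓ
    refine ⟨⟨hcont.continuousAt, ⟨ℓ, hℓ, (left hW hy).1, (right hW hy).1⟩,
      √(profileCubic m r z c), (Real.sqrt_pos.2 hpos).ne', ?_, ?_⟩, ?_⟩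
    · have h1 := (hslope.comp (by simpa using tendsto_const_sub_nhdsLT x x)).neg
      rw [neg_neg] at h1
      refine h1.congr' ?_
      filter_upwards [Ioo_mem_nhdsLT (show x - ℓ < x by linarith)] with y hyI
      exact ((left hW hy).2 y hyI).2.1.symm
    · have ht : Tendsto (fun y => y - x) (𝓝[>] x) (𝓝[>] 0) := by
        refine tendsto_nhdsWithin_of_tendsto_nhds_of_eventually_within _ ?_ ?_
        · have := ((continuous_id.sub continuous_const).tendsto x (f := fun y => y - x)).mono_left
            (nhdsWithin_le_nhds (s := Ioi x))
          simpa using this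
        · filter_upwards [self_mem_nhdsWithin] with y hy
          simpa using hy
      refine (hslope.comp ht).congr' ?_
      filter_upwards [Ioo_mem_nhdsGT (show x < x + ℓ by linarith)] with y hyI
      exact ((right hW hy).2 y hyI).2.1.symm
    · rw [eventually_nhdsWithin_iff]
      filter_upwards [Ioo_mem_nhds (show x - ℓ < x by linarith) (show x < x + ℓ by linarith)]
        with y hyI hne
      exact (off hW hy (abs_lt.2 ⟨by linarith [hyI.1], by linarith [hyI.2]⟩) hne).1.ne
  · obtain ⟨p, ℓ, W, hxp, hW, hy⟩ := h 0
    exact ⟨p, crest hW hy ((abs_nonneg _).trans_lt hxp)⟩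

/-! ### The elliptic functions -/

theorem one_sub_mul_sin_sq_pos {k : ℝ} (hk : k ^ 2 < 1) (θ : ℝ) :
    0 < 1 - k ^ 2 * Real.sin θ ^ 2 := by
  nlinarith [Real.sin_sq_le_one θ, sq_nonneg k, sq_nonneg (Real.sin θ)]

theorem contDiff_ellipticF_integrand {k : ℝ} (hk : k ^ 2 < 1) :
    ContDiff ℝ ∞ fun θ => 1 / √(1 - k ^ 2 * Real.sin θ ^ 2) :=
  contDiff_const.div
    ((contDiff_const.sub (contDiff_const.mul (Real.contDiff_sin.pow 2))).sqrt
      fun θ => (one_sub_mul_sin_sq_pos hk θ).ne')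
    fun θ => (Real.sqrt_pos.2 (one_sub_mul_sin_sq_pos hk θ)).ne'

theorem hasDerivAt_ellipticF {k : ℝ} (hk : k ^ 2 < 1) (θ : ℝ) :
    HasDerivAt (fun θ => ellipticF θ k) (1 / √(1 - k ^ 2 * Real.sin θ ^ 2)) θ :=
  intervalIntegral.integral_hasDerivAt_right
    ((contDiff_ellipticF_integrand hk).continuous.intervalIntegrable _ _)
    ((contDiff_ellipticF_integrand hk).continuous.stronglyMeasurableAtFilter _ _)
    (contDiff_ellipticF_integrand hk).continuous.continuousAt

theorem contDiff_ellipticF {k : ℝ} (hk : k ^ 2 < 1) :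
    ContDiff ℝ ∞ fun θ => ellipticF θ k := by
  refine contDiff_infty_iff_deriv.2
    ⟨fun θ => (hasDerivAt_ellipticF hk θ).differentiableAt, ?_⟩
  rw [funext fun θ => (hasDerivAt_ellipticF hk θ).deriv]
  exact contDiff_ellipticF_integrand hk

theorem ellipticF_integrand_pos {k : ℝ} (hk : k ^ 2 < 1) (θ : ℝ) :
    0 < 1 / √(1 - k ^ 2 * Real.sin θ ^ 2) :=
  one_div_pos.2 (Real.sqrt_pos.2 (one_sub_mul_sin_sq_pos hk θ))

theorem strictMono_ellipticF {k : ℝ} (hk : k ^ 2 < 1) : StrictMono fun θ => ellipticF θ k :=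
  strictMono_of_deriv_pos fun θ => by
    rw [(hasDerivAt_ellipticF hk θ).deriv]
    exact ellipticF_integrand_pos hk θ

@[simp] theorem ellipticF_zero (k : ℝ) : ellipticF 0 k = 0 := by simp [ellipticF]

theorem ellipticF_neg (θ k : ℝ) : ellipticF (-θ) k = - ellipticF θ k := by
  have := intervalIntegral.integral_comp_neg (a := 0) (b := θ)
    (fun θ => 1 / √(1 - k ^ 2 * Real.sin θ ^ 2))
  simp only [Real.sin_neg, neg_sq, neg_zero] at this
  rw [ellipticF, ellipticF, this, intervalIntegral.integral_symm]

/-- `F(·, k)` as an order isomorphism, with inverse `am(·, k)`. -/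
noncomputable def ellipticFOrderIso {k : ℝ} (hk : k ^ 2 < 1) : ℝ ≃o ℝ :=
  (strictMono_ellipticF hk).orderIsoOfRightInverse _ (fun u => ellipticAm u k)
    (ellipticF_ellipticAm hk)

theorem ellipticAm_ellipticF {k : ℝ} (hk : k ^ 2 < 1) (θ : ℝ) :
    ellipticAm (ellipticF θ k) k = θ :=
  (strictMono_ellipticF hk).injective (ellipticF_ellipticAm hk _)

theorem strictMono_ellipticAm {k : ℝ} (hk : k ^ 2 < 1) : StrictMono fun u => ellipticAm u k :=
  (ellipticFOrderIso hk).symm.strictMono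

theorem ellipticAm_neg {k : ℝ} (hk : k ^ 2 < 1) (u : ℝ) :
    ellipticAm (-u) k = - ellipticAm u k := by
  refine (strictMono_ellipticF hk).injective ?_
  simp only [ellipticF_neg, ellipticF_ellipticAm hk]

theorem ellipticAm_zero {k : ℝ} (hk : k ^ 2 < 1) : ellipticAm 0 k = 0 := by
  simpa using ellipticAm_ellipticF hk 0

theorem contDiff_ellipticAm {k : ℝ} (hk : k ^ 2 < 1) : ContDiff ℝ ∞ fun u => ellipticAm u k :=
  (ellipticFOrderIso hk).toHomeomorph.contDiff_symm_deriv
    (fun θ => (ellipticF_integrand_pos hk θ).ne') (hasDerivAt_ellipticF hk) (contDiff_ellipticF hk)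

theorem hasDerivAt_ellipticAm {k : ℝ} (hk : k ^ 2 < 1) (u : ℝ) :
    HasDerivAt (fun u => ellipticAm u k) (√(1 - k ^ 2 * Real.sin (ellipticAm u k) ^ 2)) u := by
  have := HasDerivAt.of_local_left_inverse (g := fun u => ellipticAm u k)
    (contDiff_ellipticAm hk).continuous.continuousAt (hasDerivAt_ellipticF hk (ellipticAm u k))
    (ellipticF_integrand_pos hk _).ne' (Eventually.of_forall fun v => ellipticF_ellipticAm hk v)
  simpa using this

theorem jacobiTn_neg {k : ℝ} (hk : k ^ 2 < 1) (u : ℝ) : jacobiTn (-u) k = - jacobiTn u k := by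
  simp [jacobiTn, ellipticAm_neg hk, neg_div]

theorem jacobiTn_zero {k : ℝ} (hk : k ^ 2 < 1) : jacobiTn 0 k = 0 := by
  simp [jacobiTn, ellipticAm_zero hk]

theorem jacobiTn_eq_tan (u k : ℝ) : jacobiTn u k = Real.tan (ellipticAm u k) := by
  rw [jacobiTn, Real.tan_eq_sin_div_cos]

theorem ellipticAm_mem_Ioo {k θ u : ℝ} (hk : k ^ 2 < 1)
    (hu : u ∈ Ioo (-ellipticF θ k) (ellipticF θ k)) : ellipticAm u k ∈ Ioo (-θ) θ := by
  rw [← ellipticF_neg] at hu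
  constructor
  · simpa [ellipticAm_ellipticF hk] using strictMono_ellipticAm hk hu.1
  · simpa [ellipticAm_ellipticF hk] using strictMono_ellipticAm hk hu.2

/-- The slope of `tn` as a function of its value. -/
noncomputable def tnSlope (κ t : ℝ) : ℝ := √((1 + t ^ 2) * (1 + κ * t ^ 2))

/-- On this interval the amplitude stays in `(-π/2, π/2)`, away from the poles. Expressing the slope
through the value lets the derivative be differentiated again without returning to `am`. -/
theorem hasDerivAt_jacobiTn {k u : ℝ} (hk : k ^ 2 < 1)
    (hu : u ∈ Ioo (-ellipticF (Real.pi / 2) k) (ellipticF (Real.pi / 2) k)) :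
    HasDerivAt (fun u => jacobiTn u k) (tnSlope (1 - k ^ 2) (jacobiTn u k)) u := by
  have hcos : 0 < Real.cos (ellipticAm u k) := Real.cos_pos_of_mem_Ioo (by
    simpa [neg_div] using ellipticAm_mem_Ioo hk hu)
  have hd := hasDerivAt_ellipticAm hk u
  have h1 := hd.sin.div hd.cos hcos.ne'
  refine h1.congr_deriv ?_
  have hpos := one_sub_mul_sin_sq_pos hk (ellipticAm u k)
  have h2 : (1 + jacobiTn u k ^ 2) * (1 + (1 - k ^ 2) * jacobiTn u k ^ 2) =
      (√(1 - k ^ 2 * Real.sin (ellipticAm u k) ^ 2) / Real.cos (ellipticAm u k) ^ 2) ^ 2 := by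
    rw [div_pow, Real.sq_sqrt hpos.le, jacobiTn]
    have hs := Real.sin_sq_add_cos_sq (ellipticAm u k)
    field_simp
    have hc : Real.cos (ellipticAm u k) ^ 2 = 1 - Real.sin (ellipticAm u k) ^ 2 := by linarith
    rw [hc]; ring
  rw [tnSlope, h2, Real.sqrt_sq (by positivity)]
  field_simp
  linarith [Real.sin_sq_add_cos_sq (ellipticAm u k)]

theorem contDiffOn_jacobiTn {k : ℝ} (hk : k ^ 2 < 1) :
    ContDiffOn ℝ ∞ (fun u => jacobiTn u k)
      (Ioo (-ellipticF (Real.pi / 2) k) (ellipticF (Real.pi / 2) k)) := by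
  refine ContDiffOn.div (Real.contDiff_sin.comp (contDiff_ellipticAm hk)).contDiffOn
    (Real.contDiff_cos.comp (contDiff_ellipticAm hk)).contDiffOn fun u hu => ?_
  exact (Real.cos_pos_of_mem_Ioo (by simpa [neg_div] using ellipticAm_mem_Ioo hk hu)).ne'

/-! ### The model arcs -/

theorem deriv_eq_neg_sqrt {d x : ℝ} (h : d ≤ 0) (hx : d ^ 2 = x) : d = -√x := by
  rw [← hx, Real.sqrt_sq_eq_abs, abs_of_nonpos h, neg_neg]

/-- Verification with an explicit derivative `V` on an open set containing the closed arc, so that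
derivatives at the crest are two-sided. -/
theorem isPeakonArc_of_hasDerivAt {m r z c ℓ : ℝ} {W V : ℝ → ℝ} {U : Set ℝ} (hU : IsOpen U)
    (hUI : Icc 0 ℓ ⊆ U) (hℓ : 0 < ℓ) (hW : ContDiffOn ℝ ∞ W U) (h0 : W 0 = c)
    (hmem : ∀ x ∈ Ioo 0 ℓ, m ≤ W x ∧ W x < c) (hV : ∀ x ∈ U, HasDerivAt W (V x) x)
    (hV0 : V 0 ≤ 0) (hsq : ∀ x ∈ U, V x ^ 2 = profileCubic m r z (W x))
    (hV' : ∀ x ∈ U, HasDerivAt V (profileForce m r z (W x)) x) :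
    IsPeakonArc m r z c ℓ W := by
  have hI : ∀ x ∈ Ioo 0 ℓ, x ∈ U := fun x hx => hUI ⟨hx.1.le, hx.2.le⟩
  have h0U : (0 : ℝ) ∈ U := hUI ⟨le_rfl, hℓ.le⟩
  have hd : EqOn (deriv W) V U := fun x hx => (hV x hx).deriv
  refine ⟨hW.continuousOn.mono hUI, h0, ?_, hmem, ?_, fun x hx => ?_, fun x hx => ?_⟩
  · obtain ⟨ε, hε, hb⟩ := Metric.isOpen_iff.1 hU 0 h0U
    rw [Real.ball_eq_Ioo, zero_sub, zero_add] at hb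
    refine ⟨ε, hε, hW.mono fun x hx => ?_⟩
    rcases lt_or_ge x 0 with h | h
    · exact hb ⟨hx.1, h.trans hε⟩
    · exact hUI ⟨h, hx.2.le⟩
  · rw [hd h0U]
    exact deriv_eq_neg_sqrt hV0 (by rw [hsq 0 h0U, h0])
  · rw [hd (hI x hx), hsq x (hI x hx)]
  · rw [hd.deriv hU (hI x hx), (hV' x (hI x hx)).deriv]

/-- The solitary arc. -/
theorem isPeakonArc_exp {m z c A D q₀ ℓ : ℝ} (hz : z = m - A) (hD : D ^ 2 = A / 2) (hD0 : 0 < D)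
    (hq0 : 0 < q₀) (hq1 : q₀ < 1) (hc : 4 * A * q₀ / (q₀ - 1) ^ 2 = c - m) (hℓ : 0 < ℓ) :
    IsPeakonArc m m z c ℓ
      (fun x => m + 4 * A * q₀ * Real.exp (-D * x) / (q₀ * Real.exp (-D * x) - 1) ^ 2) := by
  have hA : A = 2 * D ^ 2 := by linarith
  have hA0 : 0 < A := by rw [hA]; positivity
  -- Since `q' = -D q`, all the required equations become rational identities in `q`, valid where `q
  -- < 1`.
  set q : ℝ → ℝ := fun x => q₀ * Real.exp (-D * x) with hq
  have hqpos : ∀ x, 0 < q x := fun x => mul_pos hq0 (Real.exp_pos _)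
  have hqc : ContDiff ℝ ∞ q := by simp only [hq]; fun_prop
  have hqd : ∀ x, HasDerivAt q (-D * q x) x := fun x => by
    have := (((hasDerivAt_id x).const_mul (-D)).exp).const_mul q₀
    refine this.congr_deriv ?_
    simp only [hq, id]; ring
  have hW : (fun x => m + 4 * A * q₀ * Real.exp (-D * x) / (q₀ * Real.exp (-D * x) - 1) ^ 2) =
      fun x => m + 4 * A * q x / (q x - 1) ^ 2 := by
    ext x; simp only [hq]; ring
  have hq00 : q 0 = q₀ := by simp [hq]
  have hqlt : ∀ x, 0 < x → q x < q₀ := fun x hx => by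
    have : Real.exp (-D * x) < 1 := Real.exp_lt_one_iff.2 (by nlinarith)
    simp only [hq]; nlinarith
  rw [hW]
  have hne : ∀ x ∈ {x | q x < 1}, q x - 1 ≠ 0 := fun x hx => (sub_neg.2 hx).ne
  refine isPeakonArc_of_hasDerivAt (U := {x | q x < 1})
    (V := fun x => 4 * A * D * (q x * (1 + q x)) / (q x - 1) ^ 3)
    (isOpen_lt hqc.continuous continuous_const) (fun x hx => ?_) hℓ ?_ ?_ (fun x hx => ⟨?_, ?_⟩)
    (fun x hx => ?_) ?_ (fun x hx => ?_) (fun x hx => ?_)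
  · rcases hx.1.eq_or_lt with rfl | h
    · show q 0 < 1
      rwa [hq00]
    · exact (hqlt x h).trans hq1
  · exact contDiffOn_const.add ((contDiff_const.mul hqc).contDiffOn.div
      ((hqc.sub contDiff_const).pow 2).contDiffOn fun x hx => pow_ne_zero 2 (hne x hx))
  · simp only [hq00, hc]; ring
  · have := hqpos x
    have : 0 ≤ 4 * A * q x / (q x - 1) ^ 2 := by positivity
    linarith
  · have h1 := hqlt x hx.1
    have h2 := hqpos x
    have : 4 * A * q x / (q x - 1) ^ 2 < 4 * A * q₀ / (q₀ - 1) ^ 2 := by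
      have h4 : 0 < 1 - q₀ := by linarith
      refine div_lt_div₀ (by nlinarith) (by nlinarith) (by positivity) (by nlinarith)
    rw [hc] at this
    linarith
  · have hx' := hne x hx
    refine ((((hqd x).const_mul (4 * A)).div (((hqd x).sub_const 1).fun_pow 2)
      (pow_ne_zero 2 hx')).const_add m).congr_deriv ?_
    field_simp
    push_cast
    ring
  · simp only [hq00]
    exact div_nonpos_of_nonneg_of_nonpos (by positivity)
      ((Odd.pow_neg (by decide) (sub_neg.2 hq1)).le)
  · have hx' := hne x hx
    simp only [profileCubic, hz, hA]
    field_simp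
    ring
  · have hx' := hne x hx
    refine ((((hqd x).fun_mul ((hqd x).const_add 1)).const_mul (4 * A * D)).div
      (((hqd x).sub_const 1).fun_pow 3) (pow_ne_zero 3 hx')).congr_deriv ?_
    simp only [profileForce, hz, hA]
    field_simp
    push_cast
    ring

/-- The data of the periodic arc: half of its length is `ℓ`, the amplitude there is `θ`. -/
structure IsTnData (m r z c k D ℓ θ : ℝ) : Prop where
  z_lt_r : z < r
  r_lt_m : r < m
  m_lt_c : m < c
  modulus : k ^ 2 = 1 - (m - r) / (m - z)
  D_pos : 0 < D
  D_sq : D ^ 2 = (m - z) / 8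
  theta_pos : 0 < θ
  theta_lt : θ < Real.pi / 2
  tan_sq : (m - r) * Real.tan θ ^ 2 = c - m
  length : D * ℓ = ellipticF θ k

/-- The periodic profile around a trough at `0`. -/
noncomputable def tnProfile (m r k D y : ℝ) : ℝ := m + (m - r) * jacobiTn (D * y) k ^ 2

namespace IsTnData

variable {m r z c k D ℓ θ : ℝ}

theorem modulus_sq_lt (h : IsTnData m r z c k D ℓ θ) : k ^ 2 < 1 := by
  rw [h.modulus]
  have := div_pos (sub_pos.2 h.r_lt_m) (sub_pos.2 (h.z_lt_r.trans h.r_lt_m))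
  linarith

theorem half_length_pos (h : IsTnData m r z c k D ℓ θ) : 0 < ℓ := by
  have h1 : 0 < ellipticF θ k := by
    simpa using strictMono_ellipticF h.modulus_sq_lt h.theta_pos
  rw [← h.length] at h1
  exact pos_of_mul_pos_right h1 h.D_pos.le

theorem am_length (h : IsTnData m r z c k D ℓ θ) : ellipticAm (D * ℓ) k = θ := by
  rw [h.length, ellipticAm_ellipticF h.modulus_sq_lt]

theorem even (h : IsTnData m r z c k D ℓ θ) (y : ℝ) :
    tnProfile m r k D (-y) = tnProfile m r k D y := by
  rw [tnProfile, tnProfile, mul_neg, jacobiTn_neg h.modulus_sq_lt, neg_sq]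

theorem abs_arg (h : IsTnData m r z c k D ℓ θ) (y : ℝ) :
    tnProfile m r k D |y| = tnProfile m r k D y := by
  rcases abs_choice y with e | e
  · rw [e]
  · rw [e, h.even]

theorem at_zero (h : IsTnData m r z c k D ℓ θ) : tnProfile m r k D 0 = m := by
  simp [tnProfile, jacobiTn_zero h.modulus_sq_lt]

theorem at_length (h : IsTnData m r z c k D ℓ θ) : tnProfile m r k D ℓ = c := by
  rw [tnProfile, jacobiTn_eq_tan, h.am_length, h.tan_sq]
  ring

theorem le (h : IsTnData m r z c k D ℓ θ) (y : ℝ) : m ≤ tnProfile m r k D y := by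
  have := mul_nonneg (sub_pos.2 h.r_lt_m).le (sq_nonneg (jacobiTn (D * y) k))
  rw [tnProfile]; linarith

theorem am_mem (h : IsTnData m r z c k D ℓ θ) {y : ℝ} (hy : |y| < ℓ) :
    ellipticAm (D * y) k ∈ Ioo (-θ) θ := by
  refine ellipticAm_mem_Ioo h.modulus_sq_lt ?_
  rw [← h.length]
  have := abs_lt.1 hy
  constructor <;> nlinarith [h.D_pos]

theorem lt_speed (h : IsTnData m r z c k D ℓ θ) {y : ℝ} (hy : |y| < ℓ) :
    tnProfile m r k D y < c := by
  have ham := h.am_mem hy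
  have h1 : Real.tan (ellipticAm (D * y) k) < Real.tan θ :=
    Real.tan_lt_tan_of_lt_of_lt_pi_div_two (by linarith [ham.1, h.theta_lt]) h.theta_lt ham.2
  have h2 : Real.tan (-θ) < Real.tan (ellipticAm (D * y) k) :=
    Real.tan_lt_tan_of_lt_of_lt_pi_div_two (by linarith [h.theta_lt])
      (by linarith [ham.2, h.theta_lt]) ham.1
  rw [Real.tan_neg] at h2
  have h3 := sq_lt_sq' h2 h1
  have h4 := mul_lt_mul_of_pos_left h3 (sub_pos.2 h.r_lt_m)
  rw [h.tan_sq] at h4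
  rw [tnProfile, jacobiTn_eq_tan]
  linarith

theorem eq_zero (h : IsTnData m r z c k D ℓ θ) {y : ℝ} (hy : |y| ≤ ℓ)
    (he : tnProfile m r k D y = m) : y = 0 := by
  have hlt : |y| < ℓ := by
    refine lt_of_le_of_ne hy fun e => ?_
    rw [← h.abs_arg, e, h.at_length] at he
    exact h.m_lt_c.ne' he
  have ham := h.am_mem hlt
  have h0 : (m - r) * jacobiTn (D * y) k ^ 2 = 0 := by rw [tnProfile] at he; linarith
  have h1 : Real.tan (ellipticAm (D * y) k) = Real.tan 0 := by
    rw [← jacobiTn_eq_tan, Real.tan_zero]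
    simpa [(sub_pos.2 h.r_lt_m).ne'] using h0
  have h2 := Real.injOn_tan ⟨by linarith [ham.1, h.theta_lt], by linarith [ham.2, h.theta_lt]⟩
    ⟨by linarith [Real.pi_pos], by linarith [Real.pi_pos]⟩ h1
  have h3 := ellipticF_ellipticAm h.modulus_sq_lt (D * y)
  rw [h2, ellipticF_zero] at h3
  simpa [h.D_pos.ne'] using h3.symm

/-- The periodic arc, from crest to crest. -/
theorem isPeakonArc (h : IsTnData m r z c k D ℓ θ) :
    IsPeakonArc m r z c (2 * ℓ) (fun x => tnProfile m r k D (x - ℓ)) := by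
  have hk := h.modulus_sq_lt
  have hℓ := h.half_length_pos
  have hD := h.D_pos
  have hα : 0 < m - r := sub_pos.2 h.r_lt_m
  have hζ : 0 < m - z := sub_pos.2 (h.z_lt_r.trans h.r_lt_m)
  set κ : ℝ := 1 - k ^ 2 with hκ
  have hκ' : κ = (m - r) / (m - z) := by rw [hκ, h.modulus]; ring
  have hκpos : 0 < κ := by rw [hκ']; positivity
  set K := ellipticF (Real.pi / 2) k with hK
  -- The amplitude at the crest is below `π/2`, so the closed arc stays clear of the poles of `tn`.
  have hlK : D * ℓ < K := by
    rw [h.length]; exact strictMono_ellipticF hk h.theta_lt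
  set T : ℝ → ℝ := fun x => jacobiTn (D * (x - ℓ)) k with hT
  set U : Set ℝ := (fun x => D * (x - ℓ)) ⁻¹' Ioo (-K) K with hU
  have hTd : ∀ x ∈ U, HasDerivAt T (D * tnSlope κ (T x)) x := fun x hx => by
    have h1 := (((hasDerivAt_id x).sub_const ℓ).const_mul D)
    have := (hasDerivAt_jacobiTn hk hx).comp x h1
    refine this.congr_deriv ?_
    simp only [hT, hκ, mul_one, mul_comm]
  have hP : ∀ t, 0 < (1 + t ^ 2) * (1 + κ * t ^ 2) := fun t => by positivity
  have hSsq : ∀ t, tnSlope κ t ^ 2 = (1 + t ^ 2) * (1 + κ * t ^ 2) := fun t =>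
    Real.sq_sqrt (hP t).le
  have hSpos : ∀ t, 0 < tnSlope κ t := fun t => Real.sqrt_pos.2 (hP t)
  have hSd : ∀ t, HasDerivAt (tnSlope κ) (t * (1 + κ + 2 * κ * t ^ 2) / tnSlope κ t) t := by
    intro t
    have h1 : HasDerivAt (fun t : ℝ => t ^ 2) (2 * t) t := by
      simpa using hasDerivAt_pow 2 t
    have h2 := ((h1.const_add 1).fun_mul ((h1.const_mul κ).const_add 1)).sqrt (hP t).ne'
    refine h2.congr_deriv ?_
    rw [tnSlope]
    have := (Real.sqrt_pos.2 (hP t)).ne'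
    field_simp
    ring
  refine isPeakonArc_of_hasDerivAt (U := U)
    (V := fun x => 2 * (m - r) * D * (T x * tnSlope κ (T x)))
    (isOpen_Ioo.preimage (by fun_prop)) (fun x hx => ?_) (by linarith) ?_ ?_ (fun x hx => ?_)
    (fun x hx => ?_) ?_ (fun x hx => ?_) (fun x hx => ?_)
  · constructor <;> nlinarith [hx.1, hx.2]
  · refine contDiffOn_const.add (contDiffOn_const.mul (ContDiffOn.pow ?_ 2))
    exact (contDiffOn_jacobiTn hk).comp
      (contDiff_const.mul (contDiff_id.sub contDiff_const)).contDiffOn fun x hx => hx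
  · rw [zero_sub, h.even, h.at_length]
  · exact ⟨h.le _, h.lt_speed (abs_lt.2 ⟨by linarith [hx.1], by linarith [hx.2]⟩)⟩
  · refine ((((hTd x hx).fun_pow 2).const_mul (m - r)).const_add m).congr_deriv ?_
    push_cast
    ring
  · have hT0 : T 0 ≤ 0 := by
      simp only [hT, zero_sub, mul_neg, jacobiTn_eq_tan, ellipticAm_neg hk, Real.tan_neg,
        h.am_length]
      linarith [Real.tan_pos_of_pos_of_lt_pi_div_two h.theta_pos h.theta_lt]
    exact mul_nonpos_of_nonneg_of_nonpos (by positivity)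
      (mul_nonpos_of_nonpos_of_nonneg hT0 (hSpos _).le)
  -- With this form of the profile the cubic equation reads `T'² = (m - z)/8 * (1 + T²)(1 + κT²)`,
  -- where `κ = (m - r)/(m - z)`; this dictates `D` and the modulus.
  · have hW : tnProfile m r k D (x - ℓ) = m + (m - r) * T x ^ 2 := rfl
    simp only [hW, profileCubic]
    rw [mul_pow, mul_pow _ (tnSlope κ (T x)), hSsq, mul_pow, h.D_sq, hκ']
    field_simp
    ring
  · have hW : tnProfile m r k D (x - ℓ) = m + (m - r) * T x ^ 2 := rfl
    have h1 := ((hTd x hx).fun_mul ((hSd (T x)).comp x (hTd x hx))).const_mul (2 * (m - r) * D)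
    refine h1.congr_deriv ?_
    -- The square root occurs only squared or cancels, leaving a polynomial in `T x`.
    have h2 : 2 * (m - r) * D * (D * tnSlope κ (T x) * tnSlope κ (T x) +
        T x * (T x * (1 + κ + 2 * κ * T x ^ 2) / tnSlope κ (T x) * (D * tnSlope κ (T x)))) =
        2 * (m - r) * D ^ 2 * (tnSlope κ (T x) ^ 2 + T x ^ 2 * (1 + κ + 2 * κ * T x ^ 2)) := by
      have := (hSpos (T x)).ne'
      field_simp
    simp only [Function.comp]
    rw [h2, hSsq, h.D_sq, hW, hκ', profileForce]
    field_simp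
    ring

end IsTnData

theorem IsRootRelation.cubic_pos {m r z c : ℝ} (hzr : z < r) (hrm : r ≤ m) (hmc : m < c) :
    0 < profileCubic m r z c := by
  have h1 : 0 < c - m := by linarith
  have h2 : 0 < c - r := by linarith
  have h3 : 0 < c - z := by linarith
  unfold profileCubic; positivity

/-! ### Periodic peakons -/

/-- At a minimum the slope is zero, so the first integral compares the quartic at `m` and `c`. A
crest to the right of the trough is moved to the left by reflection. -/
theorem IsPeakonProfile.constant_of_trough {m r z c a : ℝ} {φ : ℝ → ℝ}
    (h : IsPeakonProfile c a φ) (hrel : IsRootRelation m r z c) (hmc : m ≠ c)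
    (hmem : ∀ x, m ≤ φ x) {ξ x : ℝ} (hξ : φ ξ = m) (hx : φ x = c) :
    a = profileConstant m r z c := by
  have key : ∀ {f : ℝ → ℝ} {ξ x : ℝ}, IsPeakonProfile c a f → (∀ x, m ≤ f x) → f ξ = m →
      f x = c → x < ξ → a = profileConstant m r z c := by
    intro f ξ x hf hm hξ hx hlt
    have h1 := hf.first_integral hx hlt (by rwa [hξ])
    have hmin : IsLocalMin f ξ := Eventually.of_forall fun y => hξ ▸ hm y
    rw [hmin.deriv_eq_zero, hξ] at h1
    exact hrel.constant_eq hmc (by linarith)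
  rcases lt_trichotomy x ξ with hlt | rfl | hgt
  · exact key h hmem hξ hx hlt
  · exact absurd (hξ.symm.trans hx) hmc
  · exact key (h.comp_const_sub 0) (fun _ => hmem _) (ξ := -ξ) (x := -x) (by simpa using hξ)
      (by simpa using hx) (by linarith)

theorem exists_int_mem_Ico {L : ℝ} (hL : 0 < L) (p x : ℝ) :
    ∃ n : ℤ, p + n * L ≤ x ∧ x < p + n * L + L := by
  refine ⟨⌊(x - p) / L⌋, ?_, ?_⟩
  · have := (le_div_iff₀ hL).1 (Int.floor_le ((x - p) / L))
    linarith
  · have := (div_lt_iff₀ hL).1 (Int.lt_floor_add_one ((x - p) / L))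
    linarith

namespace IsTnData

variable {m r z c k D ℓ θ : ℝ} {φ : ℝ → ℝ}

/-- One crest starts an arc of length `2 * ℓ` ending in a crest, so crests recur along a lattice
with identical arcs between them. -/
theorem eq_of_peakon (h : IsTnData m r z c k D ℓ θ) (hrel : IsRootRelation m r z c)
    (hφ : IsPeriodicPeakon c m c φ) {ξ₀ : ℝ} (hξ₀ : φ ξ₀ = m) :
    Function.Periodic φ (2 * ℓ) ∧ ∀ ξ, |ξ - ξ₀| ≤ ℓ → φ ξ = tnProfile m r k D |ξ - ξ₀| := by
  obtain ⟨hpk, -, ⟨-, hm⟩, ⟨p, hp⟩, hM⟩ := hφ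
  have hmem : ∀ x, φ x ∈ Icc m c := fun x => ⟨hm ⟨x, rfl⟩, hM ⟨x, rfl⟩⟩
  have hpos := IsRootRelation.cubic_pos h.z_lt_r h.r_lt_m.le h.m_lt_c
  have hℓ := h.half_length_pos
  have hL : 0 < 2 * ℓ := by linarith
  obtain ⟨a, ha⟩ := hpk.exists_profile
  obtain rfl := ha.constant_of_trough hrel h.m_lt_c.ne (fun x => (hmem x).1) hξ₀ hp
  have harc : ∀ {q}, φ q = c → ∀ y, |y - q| ≤ 2 * ℓ → φ y = tnProfile m r k D (|y - q| - ℓ) :=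
    fun hq y hy => ha.eq_arc_abs hrel hpos hmem hq h.isPeakonArc hL hy
  have hadd : ∀ {q}, φ q = c → φ (q + 2 * ℓ) = c := fun {q} hq => by
    have e : |q + 2 * ℓ - q| = 2 * ℓ := by rw [add_sub_cancel_left, abs_of_pos hL]
    rw [harc hq _ e.le, e, show 2 * ℓ - ℓ = ℓ by ring, h.at_length]
  have hsub : ∀ {q}, φ q = c → φ (q - 2 * ℓ) = c := fun {q} hq => by
    have e : |q - 2 * ℓ - q| = 2 * ℓ := by rw [sub_sub_cancel_left, abs_neg, abs_of_pos hL]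
    rw [harc hq _ e.le, e, show 2 * ℓ - ℓ = ℓ by ring, h.at_length]
  have hcrest : ∀ n : ℤ, φ (p + n * (2 * ℓ)) = c := by
    intro n
    induction n with
    | zero => simpa using hp
    | succ n ih => convert hadd ih using 2; push_cast; ring
    | pred n ih => convert hsub ih using 2; push_cast; ring
  have hnear : ∀ x, ∃ q, φ q = c ∧ q ≤ x ∧ x < q + 2 * ℓ := fun x => by
    obtain ⟨n, h1, h2⟩ := exists_int_mem_Ico hL p x
    exact ⟨_, hcrest n, h1, h2⟩
  have hright : ∀ {q}, φ q = c → ∀ y, q ≤ y → y ≤ q + 2 * ℓ →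
      φ y = tnProfile m r k D (y - q - ℓ) := fun {q} hq y h1 h2 => by
    have e : |y - q| = y - q := abs_of_nonneg (by linarith)
    rw [harc hq y (by rw [e]; linarith), e]
  refine ⟨fun x => ?_, fun ξ hξ => ?_⟩
  · obtain ⟨q, hq, h1, h2⟩ := hnear x
    rw [hright hq x h1 h2.le, hright (hadd hq) (x + 2 * ℓ) (by linarith) (by linarith)]
    congr 1; ring
  · obtain ⟨q, hq, h1, h2⟩ := hnear ξ₀
    have h3 := hright hq ξ₀ h1 h2.le
    rw [hξ₀] at h3
    -- An arc attains `m` only at its midpoint, hence `ξ₀ = q + ℓ`.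
    have h4 := h.eq_zero (abs_le.2 ⟨by linarith, by linarith⟩) h3.symm
    have h5 := abs_le.1 hξ
    rw [hright hq ξ (by linarith) (by linarith), h.abs_arg]
    congr 1; linarith

theorem peakon_of_eq (h : IsTnData m r z c k D ℓ θ) (hrel : IsRootRelation m r z c) {ξ₀ : ℝ}
    (hper : Function.Periodic φ (2 * ℓ))
    (hφ : ∀ ξ, |ξ - ξ₀| ≤ ℓ → φ ξ = tnProfile m r k D |ξ - ξ₀|) :
    IsPeriodicPeakon c m c φ ∧ φ ξ₀ = m := by
  have hpos := IsRootRelation.cubic_pos h.z_lt_r h.r_lt_m.le h.m_lt_c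
  have hℓ := h.half_length_pos
  have hL : 0 < 2 * ℓ := by linarith
  have htrough : φ ξ₀ = m := by rw [hφ ξ₀ (by simpa using hℓ.le)]; simp [h.at_zero]
  have hnear : ∀ (n : ℤ) y, |y - (ξ₀ + n * (2 * ℓ))| ≤ ℓ →
      φ y = tnProfile m r k D (y - (ξ₀ + n * (2 * ℓ))) := fun n y hy => by
    rw [← hper.sub_int_mul_eq n, hφ _ (by convert hy using 2; ring), h.abs_arg]
    congr 1; ring
  have hcrest : ∀ (n : ℤ) y, |y - (ξ₀ - ℓ + n * (2 * ℓ))| ≤ 2 * ℓ →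
      φ y = tnProfile m r k D (|y - (ξ₀ - ℓ + n * (2 * ℓ))| - ℓ) := by
    intro n y hy
    have hy' := abs_le.1 hy
    rcases le_total (ξ₀ - ℓ + n * (2 * ℓ)) y with hle | hle
    · rw [abs_of_nonneg (by linarith), hnear n y (abs_le.2 ⟨by linarith, by linarith⟩)]
      congr 1; ring
    -- Left of the crest lies the previous trough, and evenness of the profile turns it into the
    -- mirrored arc.
    · rw [abs_of_nonpos (by linarith), hnear (n - 1) y
        (abs_le.2 ⟨by push_cast; linarith, by push_cast; linarith⟩), ← h.even]
      congr 1; push_cast; ring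
  have hval : ∀ y, ∃ t, |t| ≤ ℓ ∧ φ y = tnProfile m r k D t := fun y => by
    obtain ⟨n, h1, h2⟩ := exists_int_mem_Ico hL (ξ₀ - ℓ) y
    have hy : |y - (ξ₀ + n * (2 * ℓ))| ≤ ℓ := abs_le.2 ⟨by linarith, by linarith⟩
    exact ⟨_, hy, hnear n y hy⟩
  refine ⟨⟨?_, ⟨2 * ℓ, hL, hper⟩, ⟨⟨ξ₀, htrough⟩, ?_⟩, ⟨ξ₀ + ℓ, ?_⟩, ?_⟩, htrough⟩
  · refine isPeakon_of_locally_arc hrel hpos fun x => ?_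
    obtain ⟨n, h1, h2⟩ := exists_int_mem_Ico hL (ξ₀ - ℓ) x
    exact ⟨_, 2 * ℓ, _, abs_lt.2 ⟨by linarith, by linarith⟩, h.isPeakonArc,
      fun y hy => hcrest n y hy.le⟩
  · rintro _ ⟨y, rfl⟩
    obtain ⟨t, -, ht⟩ := hval y
    rw [ht]
    exact h.le t
  · have e : |ξ₀ + ℓ - ξ₀| = ℓ := by rw [add_sub_cancel_left, abs_of_pos hℓ]
    rw [hφ _ e.le, e, h.at_length]
  · rintro _ ⟨y, rfl⟩
    obtain ⟨t, ht, hy⟩ := hval y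
    rw [hy]
    rcases ht.eq_or_lt with e | hlt
    · rw [← h.abs_arg, e, h.at_length]
    · exact (h.lt_speed hlt).le

theorem exists_peakon (h : IsTnData m r z c k D ℓ θ) (hrel : IsRootRelation m r z c) :
    ∃ φ, IsPeriodicPeakon c m c φ := by
  have hℓ := h.half_length_pos
  have hL : 0 < 2 * ℓ := by linarith
  set φ : ℝ → ℝ := fun x => tnProfile m r k D (toIocMod hL (-ℓ) x) with hφ
  have hper : Function.Periodic φ (2 * ℓ) := fun x => by simp only [hφ, toIocMod_add_right]
  have hin : ∀ x ∈ Ioc (-ℓ) ℓ, φ x = tnProfile m r k D x := fun x hx => by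
    simp only [hφ]
    rw [(toIocMod_eq_self hL).2 ⟨hx.1, by linarith [hx.2]⟩]
  refine ⟨φ, (h.peakon_of_eq hrel (ξ₀ := 0) hper fun ξ hξ => ?_).1⟩
  rw [sub_zero] at hξ ⊢
  rw [h.abs_arg]
  have hξ' := abs_le.1 hξ
  -- The fundamental domain `(-ℓ, ℓ]` omits `-ℓ`, which is reached by periodicity and evenness.
  rcases hξ'.1.eq_or_lt with e | hlt
  · rw [← e, h.even, ← hper (-ℓ), show -ℓ + 2 * ℓ = ℓ by ring]
    exact hin ℓ ⟨by linarith, le_rfl⟩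
  · exact hin ξ ⟨hlt, hξ'.2⟩

/-- A period moves a trough to a trough, and within `ℓ` of a trough there is no other; a period
between `ℓ` and `2 * ℓ` is first reduced by `2 * ℓ`. -/
theorem isLeast_period (h : IsTnData m r z c k D ℓ θ) (hrel : IsRootRelation m r z c)
    (hφ : IsPeriodicPeakon c m c φ) : IsLeast {T : ℝ | 0 < T ∧ Function.Periodic φ T} (2 * ℓ) := by
  have hℓ := h.half_length_pos
  obtain ⟨ξ₀, hξ₀⟩ := hφ.2.2.1.1
  obtain ⟨hper, hf⟩ := h.eq_of_peakon hrel hφ hξ₀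
  refine ⟨⟨by linarith, hper⟩, fun T ⟨hT, hTp⟩ => ?_⟩
  have hzero : ∀ t, |t| ≤ ℓ → φ (ξ₀ + t) = m → t = 0 := fun t ht he => by
    rw [hf _ (by simpa using ht), add_sub_cancel_left, h.abs_arg] at he
    exact h.eq_zero ht he
  by_contra hlt
  rw [not_le] at hlt
  rcases le_total T ℓ with hle | hle
  · exact hT.ne' (hzero T (by rwa [abs_of_pos hT]) (by rw [hTp, hξ₀]))
  · have := hzero (T - 2 * ℓ) (abs_le.2 ⟨by linarith, by linarith⟩) (by
      rw [← add_sub_assoc, hper.sub_eq, hTp, hξ₀])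
    linarith

end IsTnData

/-! ### Peakons with decay -/

theorem DecaysExponentiallyTo.tendsto {φ : ℝ → ℝ} {m : ℝ} (h : DecaysExponentiallyTo φ m) :
    Tendsto φ atTop (𝓝 m) := by
  obtain ⟨K, κ, R, hκ, -, -, hb⟩ := h
  have h1 : Tendsto (fun x : ℝ => m + K * Real.exp (-κ * x)) atTop (𝓝 m) := by
    have := (Real.tendsto_exp_atBot.comp
      (tendsto_id.const_mul_atTop_of_neg (neg_lt_zero.2 hκ))).const_mul K |>.const_add m
    simpa using this
  refine tendsto_of_tendsto_of_tendsto_of_le_of_le' tendsto_const_nhds h1 ?_ ?_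
  · filter_upwards [eventually_ge_atTop R] with x hx
    exact (hb x (hx.trans (le_abs_self x))).1.le
  · filter_upwards [eventually_ge_atTop R, eventually_ge_atTop 0] with x hx hx0
    have := (hb x (hx.trans (le_abs_self x))).2
    rw [abs_of_nonneg hx0] at this
    linarith

/-- No trough exists here. The mean value theorem on `[n, n + 1]` gives points going to infinity at
which the slope tends to `0`, and the first integral passes to the limit along them. -/
theorem IsPeakonProfile.constant_of_tendsto {m r z c a : ℝ} {φ : ℝ → ℝ}
    (h : IsPeakonProfile c a φ) (hrel : IsRootRelation m r z c) (hmc : m < c)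
    (hlim : Tendsto φ atTop (𝓝 m)) {p : ℝ} (hp : φ p = c) : a = profileConstant m r z c := by
  obtain ⟨R, hR⟩ := eventually_atTop.1 (hlim.eventually (gt_mem_nhds hmc))
  have hmvt : ∀ n : ℕ, R ≤ n → ∃ t ∈ Ioo (n : ℝ) (n + 1), deriv φ t = φ (n + 1) - φ n := by
    intro n hn
    obtain ⟨t, ht, he⟩ := exists_deriv_eq_slope φ (lt_add_one (n : ℝ)) h.continuous.continuousOn
      fun y hy => (h.smoothNear (hR y
        (hn.trans hy.1.le)).ne).hasDerivAt.differentiableAt.differentiableWithinAt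
    exact ⟨t, ht, by simpa using he⟩
  have hex : ∀ n : ℕ, ∃ t : ℝ, (n : ℝ) ≤ t ∧ (R ≤ n → deriv φ t = φ (n + 1) - φ n) := by
    intro n
    by_cases hn : R ≤ n
    · obtain ⟨t, ht, he⟩ := hmvt n hn
      exact ⟨t, ht.1.le, fun _ => he⟩
    · exact ⟨n, le_rfl, fun h' => absurd h' hn⟩
  choose t ht hte using hex
  have hn : Tendsto (fun n : ℕ => (n : ℝ)) atTop atTop := tendsto_natCast_atTop_atTop
  have htt : Tendsto t atTop atTop := tendsto_atTop_mono ht hn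
  have hφt : Tendsto (fun n => φ (t n)) atTop (𝓝 m) := hlim.comp htt
  have hd : Tendsto (fun n => deriv φ (t n)) atTop (𝓝 0) := by
    have h1 := (hlim.comp (tendsto_atTop_add_const_right atTop 1 hn)).sub (hlim.comp hn)
    rw [sub_self] at h1
    refine h1.congr' ?_
    filter_upwards [hn.eventually_ge_atTop R] with n hnR
    exact (hte n hnR).symm
  have hq : Continuous (profileQuartic c a) := by unfold profileQuartic; fun_prop
  have hl : Tendsto (fun n => (φ (t n) - c) * deriv φ (t n) ^ 2) atTop (𝓝 ((m - c) * 0 ^ 2)) :=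
    (hφt.sub_const c).mul (hd.pow 2)
  have hr : Tendsto (fun n => (φ (t n) - c) * deriv φ (t n) ^ 2) atTop
      (𝓝 (profileQuartic c a m - profileQuartic c a c)) := by
    refine (((hq.tendsto m).comp hφt).sub_const (profileQuartic c a c)).congr' ?_
    filter_upwards [htt.eventually_ge_atTop R, htt.eventually_gt_atTop p] with n h1 h2
    exact (h.first_integral hp h2 (hR _ h1).ne).symm
  have := tendsto_nhds_unique hl hr
  exact hrel.constant_eq hmc.ne (by linarith)

/-- The solitary profile to the right of its crest. -/
noncomputable def expProfile (m A q D x : ℝ) : ℝ :=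
  m + 4 * A * q * Real.exp (-D * x) / (q * Real.exp (-D * x) - 1) ^ 2

/-- The data of the solitary profile. -/
structure IsExpData (m z c A q D : ℝ) : Prop where
  z_eq : z = m - A
  m_lt_c : m < c
  D_sq : D ^ 2 = A / 2
  D_pos : 0 < D
  q_pos : 0 < q
  q_lt : q < 1
  crest : 4 * A * q / (q - 1) ^ 2 = c - m

namespace IsExpData

variable {m z c A q D : ℝ} {φ : ℝ → ℝ}

theorem A_pos (h : IsExpData m z c A q D) : 0 < A := by
  have h1 := h.D_sq
  have h2 := h.D_pos
  nlinarith [sq_pos_of_pos h2]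

theorem isPeakonArc (h : IsExpData m z c A q D) {ℓ : ℝ} (hℓ : 0 < ℓ) :
    IsPeakonArc m m z c ℓ (expProfile m A q D) :=
  isPeakonArc_exp h.z_eq h.D_sq h.D_pos h.q_pos h.q_lt h.crest hℓ

theorem at_zero (h : IsExpData m z c A q D) : expProfile m A q D 0 = c := by
  simp [expProfile, h.crest]

theorem antitone (h : IsExpData m z c A q D) {x y : ℝ} (hx : 0 ≤ x) (hxy : x ≤ y) :
    expProfile m A q D y ≤ expProfile m A q D x := by
  have hA := h.A_pos
  have hq := h.q_pos
  have hq1 := h.q_lt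
  have hD := h.D_pos
  have h1 : Real.exp (-D * y) ≤ Real.exp (-D * x) := Real.exp_le_exp.2 (by nlinarith)
  have h2 : Real.exp (-D * x) ≤ 1 := Real.exp_le_one_iff.2 (by nlinarith)
  have h3 := Real.exp_pos (-D * y)
  have h4 : 0 < 1 - q * Real.exp (-D * x) := by nlinarith
  have h5 : q * Real.exp (-D * y) ≤ q * Real.exp (-D * x) := mul_le_mul_of_nonneg_left h1 hq.le
  have h6 : (1 - q * Real.exp (-D * x)) ^ 2 ≤ (1 - q * Real.exp (-D * y)) ^ 2 :=
    pow_le_pow_left₀ h4.le (by linarith) 2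
  rw [expProfile, expProfile, sub_sq_comm, sub_sq_comm _ (1 : ℝ)]
  gcongr

theorem lt (h : IsExpData m z c A q D) {x : ℝ} (hx : 0 ≤ x) : m < expProfile m A q D x := by
  have hA := h.A_pos
  have hq := h.q_pos
  have h2 : Real.exp (-D * x) ≤ 1 := Real.exp_le_one_iff.2 (by nlinarith [h.D_pos])
  have h4 : q * Real.exp (-D * x) - 1 ≠ 0 := by nlinarith [h.q_lt]
  have : 0 < 4 * A * q * Real.exp (-D * x) / (q * Real.exp (-D * x) - 1) ^ 2 := by positivity
  rw [expProfile]; linarith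

/-- For `x ≥ 0` the denominator is smallest at the crest, where the quotient equals `c - m`. -/
theorem sub_le (h : IsExpData m z c A q D) {x : ℝ} (hx : 0 ≤ x) :
    expProfile m A q D x - m ≤ (c - m) * Real.exp (-D * x) := by
  have hA := h.A_pos
  have hq := h.q_pos
  have hq1 : 0 < 1 - q := sub_pos.2 h.q_lt
  have h2 : Real.exp (-D * x) ≤ 1 := Real.exp_le_one_iff.2 (by nlinarith [h.D_pos])
  have h4 : (1 - q) ^ 2 ≤ (1 - q * Real.exp (-D * x)) ^ 2 :=
    pow_le_pow_left₀ hq1.le (by nlinarith) 2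
  rw [expProfile, add_sub_cancel_left, ← h.crest, div_mul_eq_mul_div, sub_sq_comm,
    sub_sq_comm q]
  gcongr

theorem eq_of_peakon (h : IsExpData m z c A q D) (hrel : IsRootRelation m m z c)
    (hφ : IsDecayingPeakon c m c φ) {ξ₀ : ℝ} (hξ₀ : φ ξ₀ = c) (ξ : ℝ) :
    φ ξ = expProfile m A q D |ξ - ξ₀| := by
  obtain ⟨hpk, hm, ⟨-, hM⟩, hdec⟩ := hφ
  have hmem : ∀ x, φ x ∈ Icc m c := fun x => ⟨hm.1 ⟨x, rfl⟩, hM ⟨x, rfl⟩⟩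
  have hpos := IsRootRelation.cubic_pos (z := z) (by linarith [h.z_eq, h.A_pos]) le_rfl h.m_lt_c
  obtain ⟨a, ha⟩ := hpk.exists_profile
  obtain rfl := ha.constant_of_tendsto hrel h.m_lt_c hdec.tendsto hξ₀
  -- The solitary arc exists for every length, so one long enough to reach `ξ` is used.
  have hℓ : 0 < |ξ - ξ₀| + 1 := by positivity
  exact ha.eq_arc_abs hrel hpos hmem hξ₀ (h.isPeakonArc hℓ) hℓ (by linarith)

theorem decays (h : IsExpData m z c A q D) {ξ₀ : ℝ}
    (hφ : ∀ ξ, φ ξ = expProfile m A q D |ξ - ξ₀|) : DecaysExponentiallyTo φ m := by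
  have hξ := neg_abs_le ξ₀
  have hξ' := le_abs_self ξ₀
  have hD := h.D_pos
  -- The factor `exp (D * |ξ₀|)` pays for replacing `|ξ - ξ₀|` by the smaller `|ξ| - |ξ₀|`.
  refine ⟨(c - m) * Real.exp (D * |ξ₀|), D, |ξ₀|, hD, ?_, ?_, fun ξ _ => ⟨?_, ?_⟩⟩
  · intro x hx y hy hxy
    rw [mem_Ici] at hx hy
    rw [hφ, hφ, abs_of_nonneg (by linarith), abs_of_nonneg (by linarith)]
    exact h.antitone (by linarith) (by linarith)
  · intro x hx y hy hxy
    rw [mem_Iic] at hx hy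
    rw [hφ, hφ, abs_of_nonpos (by linarith), abs_of_nonpos (by linarith)]
    exact h.antitone (by linarith) (by linarith)
  · rw [hφ]; exact h.lt (abs_nonneg _)
  · rw [hφ]
    refine (h.sub_le (abs_nonneg _)).trans ?_
    rw [mul_assoc, ← Real.exp_add]
    have h1 := abs_sub_abs_le_abs_sub ξ ξ₀
    have h2 : 0 < c - m := sub_pos.2 h.m_lt_c
    gcongr
    nlinarith

theorem peakon_of_eq (h : IsExpData m z c A q D) (hrel : IsRootRelation m m z c) {ξ₀ : ℝ}
    (hφ : ∀ ξ, φ ξ = expProfile m A q D |ξ - ξ₀|) : IsDecayingPeakon c m c φ ∧ φ ξ₀ = c := by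
  have hpos := IsRootRelation.cubic_pos (z := z) (by linarith [h.z_eq, h.A_pos]) le_rfl h.m_lt_c
  have hc : φ ξ₀ = c := by rw [hφ, sub_self, abs_zero, h.at_zero]
  have hdec := h.decays hφ
  refine ⟨⟨?_, ⟨?_, fun b hb => ?_⟩, ⟨⟨ξ₀, hc⟩, ?_⟩, hdec⟩, hc⟩
  · refine isPeakon_of_locally_arc hrel hpos fun x => ?_
    exact ⟨ξ₀, |x - ξ₀| + 1, _, by linarith, h.isPeakonArc (by positivity), fun y _ => hφ y⟩
  · rintro _ ⟨x, rfl⟩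
    rw [hφ]; exact (h.lt (abs_nonneg _)).le
  · exact ge_of_tendsto' hdec.tendsto fun x => hb ⟨x, rfl⟩
  · rintro _ ⟨x, rfl⟩
    rw [hφ, ← h.at_zero]; exact h.antitone le_rfl (abs_nonneg _)

end IsExpData

/-! ### Matching the explicit constants with the model arcs. -/

theorem mainTheorem7 (z r m M c : ℝ) (hz : z = -m - r - M)
    (hell : r ^ 2 + m ^ 2 + M ^ 2 + r * m + r * M + m * M - 2 * c = 0)
    (hM : M = c) :
    -- periodic peakons
    (z < r → r < m → m < M →
      ∀ B C k k' D₁ D₂ D₃ L : ℝ,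
        B = (m - r) / (M - m) → C = (m - z) / (M - m) →
        k = Real.sqrt (B / C) → k' = Real.sqrt (1 - k ^ 2) →
        D₁ = Real.sqrt C * Real.sqrt (c - m) / (2 * Real.sqrt 2) →
        D₂ = B * (c - m) → D₃ = 2 / D₁ →
        L = D₃ * ellipticF (Real.arcsin (Real.sqrt ((1 / B) / (1 + 1 / B)))) k' →
        (∀ (φ : ℝ → ℝ) (ξ₀ : ℝ),
          (IsPeriodicPeakon c m M φ ∧ φ ξ₀ = m) ↔
            (Function.Periodic φ L ∧ ∀ ξ, |ξ - ξ₀| ≤ L / 2 →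
              φ ξ = m + D₂ * jacobiTn (D₁ * |ξ - ξ₀|) k' ^ 2)) ∧
        (∃ φ, IsPeriodicPeakon c m M φ) ∧
        (∀ φ, IsPeriodicPeakon c m M φ → IsLeast {T : ℝ | 0 < T ∧ Function.Periodic φ T} L)) ∧
    -- peakons with decay
    (z < r → r = m → m < M →
      ∀ C D₄ D₅ D₆ : ℝ,
        C = (m - z) / (M - m) →
        D₄ = 4 * C ^ 2 * (c - m) * (1 - Real.sqrt (1 + 1 / C)) ^ 2 →
        D₅ = Real.sqrt C * Real.sqrt (c - m) / Real.sqrt 2 →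
        D₆ = C * (1 - Real.sqrt (1 + 1 / C)) ^ 2 →
        ∀ (φ : ℝ → ℝ) (ξ₀ : ℝ),
          (IsDecayingPeakon c m M φ ∧ φ ξ₀ = c) ↔
            ∀ ξ, φ ξ = m + D₄ * Real.exp (-D₅ * |ξ - ξ₀|) /
              (D₆ * Real.exp (-D₅ * |ξ - ξ₀|) - 1) ^ 2) := by
  subst hM
  have hrel : IsRootRelation m r z M := ⟨hz, hell⟩
  constructor
  · intro hzr hrm hmM B C k k' D₁ D₂ D₃ L hB hC hk hk' hD₁ hD₂ hD₃ hL
    have h1 : 0 < M - m := sub_pos.2 hmM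
    have h2 : 0 < m - r := sub_pos.2 hrm
    have h3 : 0 < m - z := sub_pos.2 (hzr.trans hrm)
    have hBpos : 0 < B := by rw [hB]; positivity
    have hCpos : 0 < C := by rw [hC]; positivity
    have hD₂' : D₂ = m - r := by rw [hD₂, hB]; field_simp
    have hD₁pos : 0 < D₁ := by rw [hD₁]; positivity
    -- So the amplitude `θ` at the crest satisfies `tan² θ = 1/B`, that is `(m - r) tan² θ = M - m`.
    have hs : √((1 / B) / (1 + 1 / B)) ^ 2 = 1 / (B + 1) := by
      rw [Real.sq_sqrt (by positivity)]; field_simp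
    have hs0 : 0 < √((1 / B) / (1 + 1 / B)) := Real.sqrt_pos.2 (by positivity)
    have hs1 : √((1 / B) / (1 + 1 / B)) ^ 2 < 1 := by
      rw [hs, div_lt_one (by positivity)]; linarith
    have hdata : IsTnData m r z M k' D₁ (L / 2) (Real.arcsin (√((1 / B) / (1 + 1 / B)))) := by
      refine ⟨hzr, hrm, hmM, ?_, hD₁pos, ?_, Real.arcsin_pos.2 hs0,
        Real.arcsin_lt_pi_div_two.2 (by nlinarith), ?_, ?_⟩
      · have hkk : k ^ 2 = (m - r) / (m - z) := by
          rw [hk, Real.sq_sqrt (by positivity), hB, hC]; field_simp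
        rw [hk', Real.sq_sqrt, hkk]
        rw [hkk, sub_nonneg, div_le_one h3]; linarith
      · rw [hD₁, div_pow, mul_pow, mul_pow, Real.sq_sqrt hCpos.le, Real.sq_sqrt h1.le,
          Real.sq_sqrt (by norm_num), hC]
        field_simp
        norm_num
      · rw [Real.tan_arcsin, div_pow, Real.sq_sqrt (sub_nonneg.2 hs1.le), hs]
        have h4 : 1 - 1 / (B + 1) = B / (B + 1) := by field_simp; ring
        rw [h4, div_div_div_cancel_right₀ (by positivity), ← hD₂', hD₂]
        field_simp
      · rw [hL, hD₃]; field_simp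
    have hL2 : 2 * (L / 2) = L := by ring
    refine ⟨fun φ ξ₀ => ?_, hdata.exists_peakon hrel, fun φ hφ => ?_⟩
    · rw [hD₂']
      constructor
      · rintro ⟨hφ, h0⟩
        have := hdata.eq_of_peakon hrel hφ h0
        rwa [hL2] at this
      · rintro ⟨hper, hφ⟩
        exact hdata.peakon_of_eq hrel (by rwa [hL2]) hφ
    · have := hdata.isLeast_period hrel hφ
      rwa [hL2] at this
  · rintro hzr rfl hmM C D₄ D₅ D₆ hC hD₄ hD₅ hD₆ φ ξ₀
    have h1 : 0 < M - r := sub_pos.2 hmM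
    have h3 : 0 < r - z := sub_pos.2 hzr
    have hCpos : 0 < C := by rw [hC]; positivity
    have hAC : r - z = C * (M - r) := by rw [hC]; field_simp
    set S := √(1 + 1 / C) with hS
    have hSsq : S ^ 2 = 1 + 1 / C := Real.sq_sqrt (by positivity)
    have hCS : C * S ^ 2 = C + 1 := by rw [hSsq]; field_simp
    have hS1 : 1 < S := by
      have : 0 < 1 / C := by positivity
      rw [hS, Real.lt_sqrt (by norm_num)]; linarith
    -- Follows from `C * S ^ 2 = C + 1`. It gives both `D₆ < 1` and the crest height, since `D₆ = C
    -- * (1 - S) ^ 2` makes `D₆ / (1 - D₆) ^ 2` equal to `1 / (4 * C)`.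
    have hD₆1 : 1 - D₆ = 2 * C * (S - 1) := by rw [hD₆]; linear_combination -hCS
    have hD₆lt : D₆ < 1 := by
      have : 0 < 2 * C * (S - 1) := mul_pos (by positivity) (by linarith)
      linarith
    have hdata : IsExpData r z M (r - z) D₆ D₅ := by
      refine ⟨by ring, hmM, ?_, ?_, ?_, hD₆lt, ?_⟩
      · rw [hD₅, div_pow, mul_pow, Real.sq_sqrt hCpos.le, Real.sq_sqrt h1.le,
          Real.sq_sqrt (by norm_num), hAC]
      · rw [hD₅]; positivity
      · have : 1 - S ≠ 0 := by linarith
        rw [hD₆]; positivity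
      · have : S - 1 ≠ 0 := by linarith
        rw [sub_sq_comm, hD₆1, hAC, hD₆]
        field_simp
        ring
    have hform : ∀ x, expProfile r (r - z) D₆ D₅ x =
        r + D₄ * Real.exp (-D₅ * x) / (D₆ * Real.exp (-D₅ * x) - 1) ^ 2 := fun x => by
      rw [expProfile, hD₄, hAC, hD₆]; ring
    simp only [← hform]
    exact ⟨fun ⟨hφ, h0⟩ => hdata.eq_of_peakon hrel hφ h0, fun hφ => hdata.peakon_of_eq hrel hφ⟩
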